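/- **Notation.** Let $n\in\mathbb N$ and $\hat f(\xi)=(2\pi)^{-n/2}\int_{\mathbb R^n}e^{-ix\cdot\xi}f(x)\,dx$. Let $\mathcal Z(\mathbb R^n)$ be the space of all $g\in\mathcal S(\mathbb R^n)$ with $D^\gamma\hat g(0)=0$ for every multi-index $\gamma$, with the topology of $\mathcal S(\mathbb R^n)$, and let $\mathcal Z'(\mathbb R^n)$ be its topological dual, which is identified with $\mathcal S'/\mathcal P$, the tempered distributions modulo polynomials. Let $\hat\psi\in C_c^\infty(\mathbb R^n)$ be any radial function with $0\le\hat\psi\le1$, $\hat\psi(\xi)=1$ for $|\xi|\le1$ and $\hat\psi(\xi)=0$ for $|\xi|\ge2$. Put $\hat\phi(\xi)=\hat\psi(\xi)-\hat\psi(2\xi)$ and $\hat\phi_j(\xi)=\hat\phi(2^{-j}\xi)$ for $j\in\mathbb Z$, and let $\phi_j\in\mathcal S(\mathbb R^n)$ be the function for which convolution with $\phi_j$ is the Fourier multiplier with symbol $\hat\phi_j$. For $f\in\mathcal Z'(\mathbb R^n)$ let $\phi_j*f$ be the function $x\mapsto\langle f,\phi_j(x-\cdot)\rangle$. For $s\in\mathbb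 R$ and $1\le p,q\le\infty$, the homogeneous Besov space $\dot B^s_{p,q}(\mathbb R^n)$ is the set of all $f\in\mathcal Z'(\mathbb R^n)$ with $$\Big(\sum_{j\in\mathbb Z}\big(2^{js}\|\phi_j*f\|_p\big)^q\Big)^{1/q}<\infty\quad(1\le q<\infty),\qquad \sup_{j\in\mathbb Z}2^{js}\|\phi_j*f\|_p<\infty\quad(q=\infty).$$ For $\alpha,t>0$ the Fourier multiplier with symbol $e^{-t|\xi|^{2\alpha}}$ maps $\mathcal Z(\mathbb R^n)$ to itself, and $S_\alpha(t)=e^{-t(-\Delta)^\alpha}$ acts on $\mathcal Z'(\mathbb R^n)$ as its transpose. For $T\in\mathcal Z'(\mathbb R^n)$ write $\|T\|_p$ for the infimum of $\|u\|_{L^p}$ over all $u\in L^p(\mathbb R^n)$ that represent $T$, that is, $\langle T,g\rangle=\int_{\mathbb R^n}u\,g\,dx$ for all $g\in\mathcal Z(\mathbb R^n)$; $\|T\|_p=\infty$ if there is no such $u$. **Proposition.** Let $1\le p,q\le\infty$, $s<0$, $n\in\mathbb N$ and $0<\alpha<\infty$, and let $f\in\mathcal Z'(\mathbb R^n)$.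 Then $f\in\dot B^s_{p,q}(\mathbb R^n)$ if and only if $$\begin{cases}\displaystyle\Big(\int_0^\infty\big(t^{-\frac{s}{2\alpha}}\|S_\alpha(t)f\|_p\big)^q\,\frac{dt}{t}\Big)^{1/q}<\infty,&1\le q<\infty,\\[2mm]\displaystyle\sup_{t>0}t^{-\frac{s}{2\alpha}}\|S_\alpha(t)f\|_p<\infty,&q=\infty.\end{cases}$$ -/

import Mathlib

namespace FracHeat

open MeasureTheory Set
open scoped SchwartzMap FourierTransform ENNReal ContDiff

/-! ### Functions that are flat at the origin

Auxiliary material. It is used only to see that multiplication by `exp (-t |ξ| ^ (2α))`, whose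
symbol need not be smooth at `0`, preserves the Schwartz functions vanishing to infinite order
at `0`. -/

section Flat

variable {E F : Type*} [NormedAddCommGroup E] [NormedSpace ℝ E]
  [NormedAddCommGroup F] [NormedSpace ℝ F]

/-- The weight `|x| + 1 / |x|`, large both at infinity and at the origin. -/
noncomputable def weight {E : Type*} [NormedAddCommGroup E] (x : E) : ℝ := ‖x‖ + ‖x‖⁻¹

/-- `f` is smooth off `0` and all its derivatives decay faster than any power, at `∞` and at `0`. -/
def FlatAtZero (f : E → F) : Prop :=
  f 0 = 0 ∧ (∀ x ≠ 0, ContDiffAt ℝ ∞ f x) ∧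
    ∀ k N : ℕ, ∃ C : ℝ, ∀ x ≠ 0, weight x ^ N * ‖iteratedFDeriv ℝ k f x‖ ≤ C

/-- `f` is smooth off `0`, with derivatives of at most power growth at `∞` and at `0`. -/
def Moderate (f : E → F) : Prop :=
  (∀ x ≠ 0, ContDiffAt ℝ ∞ f x) ∧
    ∀ k : ℕ, ∃ C : ℝ, ∃ N : ℕ, ∀ x ≠ 0, ‖iteratedFDeriv ℝ k f x‖ ≤ C * weight x ^ N

theorem one_le_weight {E : Type*} [NormedAddCommGroup E] {x : E} (hx : x ≠ 0) : 1 ≤ weight x := by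
  have h : 0 < ‖x‖ := norm_pos_iff.2 hx
  unfold weight
  rcases le_total 1 ‖x‖ with h1 | h1
  · have := inv_pos.2 h
    linarith
  · have := (one_le_inv₀ h).2 h1
    linarith

theorem weight_nonneg {E : Type*} [NormedAddCommGroup E] (x : E) : 0 ≤ weight x := by unfold weight; positivity

theorem FlatAtZero.bound {f : E → F} (hf : FlatAtZero f) {m : ℕ} (hm : m ≠ 0) :
    ∃ C : ℝ, ∀ x, ‖f x‖ ≤ C * ‖x‖ ^ m := by
  obtain ⟨C, hC⟩ := hf.2.2 0 m
  refine ⟨C, fun x => ?_⟩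
  by_cases hx : x = 0
  · subst hx
    simp [hf.1, hm]
  · have h : 0 < ‖x‖ := norm_pos_iff.2 hx
    have h2 := hC x hx
    rw [norm_iteratedFDeriv_zero] at h2
    have h3 : ‖x‖⁻¹ ^ m ≤ weight x ^ m := by
      unfold weight
      gcongr
      linarith
    have h4 := (mul_le_mul_of_nonneg_right h3 (norm_nonneg (f x))).trans h2
    rw [inv_pow, inv_mul_le_iff₀ (by positivity)] at h4
    linarith

theorem FlatAtZero.differentiable {f : E → F} (hf : FlatAtZero f) :
    HasFDerivAt f (0 : E →L[ℝ] F) 0 ∧ Differentiable ℝ f := by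
  have h0 : HasFDerivAt f (0 : E →L[ℝ] F) 0 := by
    obtain ⟨C, hC⟩ := hf.bound two_ne_zero
    rw [hasFDerivAt_iff_isLittleO_nhds_zero]
    simp only [zero_add, hf.1, sub_zero, _root_.zero_apply]
    refine Asymptotics.IsBigO.trans_isLittleO (g := fun x : E => ‖x‖ ^ 2) ?_ ?_
    · exact Asymptotics.IsBigO.of_bound C (Filter.Eventually.of_forall fun x => by simpa using hC x)
    · exact Asymptotics.isLittleO_norm_pow_id one_lt_two
  refine ⟨h0, fun x => ?_⟩
  by_cases hx : x = 0
  · subst hx; exact h0.differentiableAt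
  · exact (hf.2.1 x hx).differentiableAt (by simp)

theorem FlatAtZero.fderiv {f : E → F} (hf : FlatAtZero f) : FlatAtZero (fderiv ℝ f) := by
  refine ⟨hf.differentiable.1.fderiv, fun x hx => (hf.2.1 x hx).fderiv_right (by simp), fun k N => ?_⟩
  obtain ⟨C, hC⟩ := hf.2.2 (k + 1) N
  refine ⟨C, fun x hx => ?_⟩
  rw [norm_iteratedFDeriv_fderiv]
  exact hC x hx

end Flat

theorem FlatAtZero.contDiff_nat {E : Type} [NormedAddCommGroup E] [NormedSpace ℝ E] (k : ℕ) :
    ∀ {F : Type} [NormedAddCommGroup F] [NormedSpace ℝ F] {f : E → F}, FlatAtZero f →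
      ContDiff ℝ k f ∧ iteratedFDeriv ℝ k f 0 = 0 := by
  induction k with
  | zero =>
    intro F _ _ f hf
    refine ⟨contDiff_zero.2 hf.differentiable.2.continuous, ?_⟩
    rw [← norm_eq_zero, norm_iteratedFDeriv_zero, hf.1, norm_zero]
  | succ k ih =>
    intro F _ _ f hf
    refine ⟨?_, ?_⟩
    · rw [Nat.cast_add, Nat.cast_one, contDiff_succ_iff_fderiv]
      exact ⟨hf.differentiable.2, by simp, (ih hf.fderiv).1⟩
    · rw [← norm_eq_zero, ← norm_iteratedFDeriv_fderiv, (ih hf.fderiv).2, norm_zero]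

section FlatSchwartz

variable {E F : Type} [NormedAddCommGroup E] [NormedSpace ℝ E]
  [NormedAddCommGroup F] [NormedSpace ℝ F]

/-- A function that is flat at the origin is a Schwartz function. -/
def FlatAtZero.toSchwartz (f : E → F) (hf : FlatAtZero f) : 𝓢(E, F) where
  toFun := f
  smooth' := contDiff_infty.2 fun k => (FlatAtZero.contDiff_nat k hf).1
  decay' := by
    intro k n
    obtain ⟨C, hC⟩ := hf.2.2 n k
    refine ⟨max C 0, fun x => ?_⟩
    by_cases hx : x = 0
    · subst hx
      rw [(FlatAtZero.contDiff_nat n hf).2]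
      simp
    · refine le_trans ?_ ((hC x hx).trans (le_max_left _ _))
      gcongr
      unfold weight
      have : 0 ≤ ‖x‖⁻¹ := by positivity
      linarith

theorem flat_of_iteratedFDeriv_eq_zero (f : 𝓢(E, F)) (hf : ∀ k, iteratedFDeriv ℝ k f 0 = 0) :
    FlatAtZero f := by
  have key : ∀ N k : ℕ, ∃ C : ℝ, ∀ x, ‖iteratedFDeriv ℝ k f x‖ ≤ C * ‖x‖ ^ N := by
    intro N
    induction N with
    | zero =>
      intro k
      obtain ⟨C, hC⟩ := f.decay 0 k
      exact ⟨C, fun x => by simpa using hC.2 x⟩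
    | succ N ih =>
      intro k
      obtain ⟨C, hC⟩ := ih (k + 1)
      refine ⟨C, fun x => ?_⟩
      have h := (convex_closedBall (0 : E) ‖x‖).norm_image_sub_le_of_norm_fderiv_le (𝕜 := ℝ)
        (f := iteratedFDeriv ℝ k f) (C := C * ‖x‖ ^ N) (x := 0) (y := x) ?_ ?_ (by simp) (by simp)
      · rw [hf k, sub_zero, sub_zero] at h
        rw [pow_succ, ← mul_assoc]
        exact h
      · intro y _
        exact ((f.smooth ⊤).differentiable_iteratedFDeriv (by exact_mod_cast ENat.natCast_lt_top k)) y
      · intro y hy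
        rw [norm_fderiv_iteratedFDeriv]
        have hC0 : 0 ≤ C ∨ x = 0 := by
          by_cases hx : x = 0
          · exact Or.inr hx
          · left
            have := (norm_nonneg _).trans (hC x)
            exact nonneg_of_mul_nonneg_left this (by have := norm_pos_iff.2 hx; positivity)
        rcases hC0 with h0 | h0
        · refine (hC y).trans ?_
          gcongr
          simpa using hy
        · subst h0
          have : y = 0 := by simpa using hy
          subst this
          exact hC 0
  refine ⟨?_, fun x _ => (f.smooth ⊤).contDiffAt, fun k N => ?_⟩
  · rw [← norm_eq_zero, ← norm_iteratedFDeriv_zero (𝕜 := ℝ), hf 0, norm_zero]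
  · obtain ⟨C₁, h₁⟩ := key N k
    obtain ⟨C₂, h₂⟩ := f.decay N k
    refine ⟨2 ^ N * (C₁ + C₂), fun x hx => ?_⟩
    have hx0 : 0 < ‖x‖ := norm_pos_iff.2 hx
    have hw : weight x ^ N ≤ 2 ^ N * (‖x‖⁻¹ ^ N + ‖x‖ ^ N) := by
      unfold weight
      have : ‖x‖ + ‖x‖⁻¹ ≤ 2 * max ‖x‖ ‖x‖⁻¹ := by
        have := le_max_left ‖x‖ ‖x‖⁻¹
        have := le_max_right ‖x‖ ‖x‖⁻¹
        linarith
      refine (pow_le_pow_left₀ (by positivity) this N).trans ?_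
      rw [mul_pow]
      gcongr
      rcases max_cases ‖x‖ ‖x‖⁻¹ with h | h <;> rw [h.1]
      · have : 0 ≤ ‖x‖⁻¹ ^ N := by positivity
        linarith
      · have : 0 ≤ ‖x‖ ^ N := by positivity
        linarith
    have e₁ : ‖x‖⁻¹ ^ N * ‖iteratedFDeriv ℝ k f x‖ ≤ C₁ := by
      rw [inv_pow, inv_mul_le_iff₀ (by positivity), mul_comm]
      exact h₁ x
    have e₂ := h₂.2 x
    calc _ ≤ 2 ^ N * (‖x‖⁻¹ ^ N + ‖x‖ ^ N) * ‖iteratedFDeriv ℝ k f x‖ := by gcongr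
      _ = 2 ^ N * (‖x‖⁻¹ ^ N * ‖iteratedFDeriv ℝ k f x‖ + ‖x‖ ^ N * ‖iteratedFDeriv ℝ k f x‖) := by
        ring
      _ ≤ _ := by gcongr

theorem FlatAtZero.moderate_mul {m f : E → ℂ} (hm : Moderate m) (hf : FlatAtZero f) :
    FlatAtZero (fun x => m x * f x) := by
  refine ⟨by simp [hf.1], fun x hx => (hm.1 x hx).mul (hf.2.1 x hx), fun k N => ?_⟩
  choose A M hA using hm.2
  have hB : ∀ i, ∃ C : ℝ, ∀ x ≠ 0,
      weight x ^ (M i + N) * ‖iteratedFDeriv ℝ (k - i) f x‖ ≤ C := fun i => hf.2.2 _ _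
  choose B hB using hB
  refine ⟨∑ i ∈ Finset.range (k + 1), (k.choose i : ℝ) * (|A i| * B i), fun x hx => ?_⟩
  have ho : IsOpen ({0}ᶜ : Set E) := isOpen_compl_singleton
  have h := norm_iteratedFDerivWithin_mul_le (𝕜 := ℝ) (A := ℂ) (f := m) (g := f) (s := {0}ᶜ)
    (N := ∞) (n := k) (fun y hy => (hm.1 y hy).contDiffWithinAt)
    (fun y hy => (hf.2.1 y hy).contDiffWithinAt) ho.uniqueDiffOn (x := x) hx
    (by exact_mod_cast le_top)
  simp only [iteratedFDerivWithin_of_isOpen _ ho (show x ∈ ({0}ᶜ : Set E) from hx)] at h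
  have hw := weight_nonneg x
  calc _ ≤ weight x ^ N * ∑ i ∈ Finset.range (k + 1), (k.choose i : ℝ) *
        ‖iteratedFDeriv ℝ i m x‖ * ‖iteratedFDeriv ℝ (k - i) f x‖ := by gcongr
    _ = ∑ i ∈ Finset.range (k + 1), (k.choose i : ℝ) * (weight x ^ N *
        ‖iteratedFDeriv ℝ i m x‖ * ‖iteratedFDeriv ℝ (k - i) f x‖) := by
      rw [Finset.mul_sum]
      exact Finset.sum_congr rfl fun i _ => by ring
    _ ≤ _ := by
      refine Finset.sum_le_sum fun i _ => mul_le_mul_of_nonneg_left ?_ (by positivity)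
      calc _ ≤ weight x ^ N * (|A i| * weight x ^ M i) * ‖iteratedFDeriv ℝ (k - i) f x‖ := by
            gcongr
            exact (hA i x hx).trans (by gcongr; exact le_abs_self _)
        _ = |A i| * (weight x ^ (M i + N) * ‖iteratedFDeriv ℝ (k - i) f x‖) := by ring
        _ ≤ _ := by gcongr; exact hB i x hx

theorem Moderate.comp {f : E → ℝ} (hf : Moderate f) {g : ℝ → F} {t : Set ℝ} (ht : IsOpen t)
    (hft : ∀ x ≠ 0, f x ∈ t) (hg : ContDiffOn ℝ ∞ g t)
    (hgb : ∀ k : ℕ, ∃ C : ℝ, ∃ N : ℕ, ∀ x ≠ 0,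
      ‖iteratedFDeriv ℝ k g (f x)‖ ≤ C * weight x ^ N) :
    Moderate (fun x => g (f x)) := by
  refine ⟨fun x hx => ((hg.contDiffAt (ht.mem_nhds (hft x hx))).comp x (hf.1 x hx)), fun k => ?_⟩
  choose A M hA using hf.2
  choose B L hB using hgb
  set a : ℝ := 1 + ∑ i ∈ Finset.range (k + 1), |A i|
  set μ : ℕ := ∑ i ∈ Finset.range (k + 1), M i
  set b : ℝ := ∑ i ∈ Finset.range (k + 1), |B i|
  set l : ℕ := ∑ i ∈ Finset.range (k + 1), L i
  have ha1 : 1 ≤ a := le_add_of_nonneg_right (Finset.sum_nonneg fun _ _ => abs_nonneg _)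
  refine ⟨k.factorial * b * a ^ k, l + μ * k, fun x hx => ?_⟩
  have ho : IsOpen ({0}ᶜ : Set E) := isOpen_compl_singleton
  have hw := one_le_weight hx
  have h := norm_iteratedFDerivWithin_comp_le (𝕜 := ℝ) (g := g) (f := f) (n := k) (s := {0}ᶜ)
    (t := t) (x := x) (N := ∞) hg (fun y hy => (hf.1 y hy).contDiffWithinAt)
    (by exact_mod_cast le_top) ht.uniqueDiffOn ho.uniqueDiffOn (fun y hy => hft y hy) hx
    (C := b * weight x ^ l) (D := a * weight x ^ μ) ?_ ?_
  · rw [iteratedFDerivWithin_of_isOpen _ ho (show x ∈ ({0}ᶜ : Set E) from hx)] at h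
    refine h.trans (le_of_eq ?_)
    rw [mul_pow, pow_add, pow_mul]
    ring
  · intro i hi
    rw [iteratedFDerivWithin_of_isOpen _ ht (hft x hx)]
    have hmem : i ∈ Finset.range (k + 1) := Finset.mem_range.2 (by omega)
    refine (hB i x hx).trans (mul_le_mul ?_ ?_ (by positivity)
      (Finset.sum_nonneg fun _ _ => abs_nonneg _))
    · exact (le_abs_self _).trans
        (Finset.single_le_sum (f := fun i => |B i|) (fun _ _ => abs_nonneg _) hmem)
    · exact pow_le_pow_right₀ hw
        (Finset.single_le_sum (f := L) (fun _ _ => Nat.zero_le _) hmem)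
  · intro i hi1 hi
    rw [iteratedFDerivWithin_of_isOpen _ ho (show x ∈ ({0}ᶜ : Set E) from hx)]
    have hmem : i ∈ Finset.range (k + 1) := Finset.mem_range.2 (by omega)
    have h1 : A i ≤ a := (le_abs_self _).trans
      ((Finset.single_le_sum (f := fun i => |A i|) (fun _ _ => abs_nonneg _) hmem).trans
        (le_add_of_nonneg_left zero_le_one))
    have h2 : weight x ^ M i ≤ weight x ^ μ := pow_le_pow_right₀ hw
        (Finset.single_le_sum (f := M) (fun _ _ => Nat.zero_le _) hmem)
    have h3 : ‖iteratedFDeriv ℝ i f x‖ ≤ a * weight x ^ μ :=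
      (hA i x hx).trans (mul_le_mul h1 h2 (by positivity) (by linarith))
    refine h3.trans (le_self_pow₀ ?_ (by omega))
    exact one_le_mul_of_one_le_of_one_le ha1 (one_le_pow₀ hw)

theorem rpow_le_weight {E : Type*} [NormedAddCommGroup E] {x : E} (hx : x ≠ 0) (r : ℝ) :
    (‖x‖ ^ 2) ^ r ≤ weight x ^ (2 * ⌈|r|⌉₊) := by
  have h : 0 < ‖x‖ := norm_pos_iff.2 hx
  have hw := one_le_weight hx
  have h1 : (‖x‖ ^ 2) ^ r ≤ (weight x ^ 2) ^ |r| := by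
    have hi : 0 < ‖x‖⁻¹ := inv_pos.2 h
    rcases le_total 0 r with hr | hr
    · rw [abs_of_nonneg hr]
      refine Real.rpow_le_rpow (by positivity) ?_ hr
      unfold weight
      gcongr
      linarith
    · rw [abs_of_nonpos hr, ← neg_neg r, Real.rpow_neg (by positivity), neg_neg,
        ← Real.inv_rpow (by positivity), ← inv_pow]
      refine Real.rpow_le_rpow (by positivity) ?_ (by linarith)
      unfold weight
      gcongr
      linarith
  refine h1.trans ?_
  rw [pow_mul, ← Real.rpow_natCast (weight x ^ 2)]
  exact Real.rpow_le_rpow_of_exponent_le (one_le_pow₀ hw) (Nat.le_ceil _)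

theorem moderate_norm_rpow {E : Type} [NormedAddCommGroup E] [InnerProductSpace ℝ E]
    (c r : ℝ) : Moderate (fun x : E => c * (‖x‖ ^ 2) ^ r) := by
  have h1 : Moderate (fun x : E => ‖x‖ ^ 2) := by
    have h : (fun x : E => ‖x‖ ^ 2).HasTemperateGrowth := by fun_prop
    refine ⟨fun x _ => h.1.contDiffAt, fun k => ?_⟩
    obtain ⟨N, C, hC⟩ := h.2 k
    refine ⟨|C| * 2 ^ N, N, fun x hx => (hC x).trans ?_⟩
    rw [mul_assoc, ← mul_pow]
    have := one_le_weight hx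
    have h0 : ‖x‖ ≤ weight x := by
      unfold weight
      have : 0 ≤ ‖x‖⁻¹ := by positivity
      linarith
    gcongr
    · exact le_abs_self _
    · linarith
  refine h1.comp (g := fun y : ℝ => c * y ^ r) (t := Ioi 0) isOpen_Ioi ?_ ?_ ?_
  · intro x hx
    have := norm_pos_iff.2 hx
    exact mem_Ioi.2 (by positivity)
  · exact contDiffOn_const.mul
      (contDiffOn_fun_id.rpow_const_of_ne fun y hy => ne_of_gt hy)
  · intro k
    refine ⟨|c| * |(descPochhammer ℝ k).eval r|, 2 * ⌈|r - k|⌉₊, fun x hx => ?_⟩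
    rw [norm_iteratedFDeriv_eq_norm_iteratedDeriv, iteratedDeriv_const_mul_field,
      iteratedDeriv_eq_iterate, Real.iter_deriv_rpow_const]
    simp only [norm_mul, Real.norm_eq_abs]
    rw [mul_assoc, abs_of_nonneg (a := (‖x‖ ^ 2) ^ (r - k)) (by positivity)]
    gcongr
    exact rpow_le_weight hx _

theorem moderate_exp_neg {E : Type} [NormedAddCommGroup E] [InnerProductSpace ℝ E]
    {c : ℝ} (hc : 0 ≤ c) (r : ℝ) :
    Moderate (fun x : E => ((Real.exp (-c * (‖x‖ ^ 2) ^ r) : ℝ) : ℂ)) := by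
  refine (moderate_norm_rpow (E := E) (-c) r).comp (g := fun y : ℝ => ((Real.exp y : ℝ) : ℂ))
    isOpen_univ (fun _ _ => mem_univ _)
    (Complex.ofRealCLM.contDiff.comp Real.contDiff_exp).contDiffOn fun k => ?_
  refine ⟨1, 0, fun x hx => ?_⟩
  have e : (fun y : ℝ => ((Real.exp y : ℝ) : ℂ)) = Complex.ofRealLI ∘ Real.exp := rfl
  rw [e, LinearIsometry.norm_iteratedFDeriv_comp_left _ (Real.contDiff_exp (n := ∞)).contDiffAt
    (by exact_mod_cast le_top), norm_iteratedFDeriv_eq_norm_iteratedDeriv,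
    iteratedDeriv_eq_iterate, Real.iter_deriv_exp, Real.norm_eq_abs, Real.abs_exp]
  simp only [pow_zero, mul_one, Real.exp_le_one_iff]
  have : 0 ≤ c * (‖x‖ ^ 2) ^ r := by positivity
  linarith
end FlatSchwartz

/-! ### The spaces `𝒵(ℝⁿ)` and `𝒵'(ℝⁿ)`

Mathlib's Fourier transform is `𝓕 g ξ = ∫ exp (-2πi x·ξ) g x dx`. The one normalised with
`exp (-i x·ξ)` is, up to a constant factor, `ξ ↦ 𝓕 g (ξ / 2π)`; hence a symbol `m ξ` in the latter
convention is `m (2π ξ)` in the former. -/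

/-- `ℝⁿ` with the Euclidean norm. -/
abbrev Eu (n : ℕ) : Type := EuclideanSpace ℝ (Fin n)

/-- `𝒵(ℝⁿ)`: the Schwartz functions all of whose Fourier derivatives vanish at the origin. -/
noncomputable def Z (n : ℕ) : Submodule ℂ 𝓢(Eu n, ℂ) where
  carrier := {g | ∀ k : ℕ, iteratedFDeriv ℝ k (𝓕 g : 𝓢(Eu n, ℂ)) 0 = 0}
  zero_mem' := by
    intro k
    have h : ((𝓕 (0 : 𝓢(Eu n, ℂ)) : 𝓢(Eu n, ℂ)) : Eu n → ℂ) = fun _ => 0 := by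
      rw [FourierTransform.fourier_zero]; rfl
    rw [h, iteratedFDeriv_fun_zero]
    rfl
  add_mem' := by
    intro a b ha hb k
    have h : ((𝓕 (a + b) : 𝓢(Eu n, ℂ)) : Eu n → ℂ)
        = (𝓕 a : 𝓢(Eu n, ℂ)) + (𝓕 b : 𝓢(Eu n, ℂ)) := by
      rw [FourierTransform.fourier_add]; rfl
    rw [h, iteratedFDeriv_add_apply ((SchwartzMap.contDiffAt _ ⊤).of_le (by exact_mod_cast le_top))
      ((SchwartzMap.contDiffAt _ ⊤).of_le (by exact_mod_cast le_top)), ha k, hb k, add_zero]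
  smul_mem' := by
    intro c a ha k
    have h : ((𝓕 (c • a) : 𝓢(Eu n, ℂ)) : Eu n → ℂ) = c • (𝓕 a : 𝓢(Eu n, ℂ)) := by
      rw [FourierTransform.fourier_smul]; rfl
    rw [h, iteratedFDeriv_const_smul_apply
      ((SchwartzMap.contDiffAt _ ⊤).of_le (by exact_mod_cast le_top)), ha k, smul_zero]

/-- `𝒵'(ℝⁿ)`: the continuous linear functionals on `𝒵(ℝⁿ)`, with the topology induced by `𝒮(ℝⁿ)`. -/
abbrev ZDual (n : ℕ) : Type := Z n →L[ℂ] ℂ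

/-- The `L^p` norm of a functional `T` on `𝒵(ℝⁿ)`. An element of `𝒵' ≅ 𝒮'/𝒫` is a distribution
modulo polynomials, and its norm is the least `L^p` norm of a function representing it, and `∞` if
no function in `L^p` represents it. (The representative in `L^p` is unique if `p < ∞`; for `p = ∞`
it is unique up to a constant.) -/
noncomputable def distNorm {n : ℕ} (p : ℝ≥0∞) (T : Z n →ₗ[ℂ] ℂ) : ℝ≥0∞ :=
  ⨅ (u : Eu n → ℂ) (_ : MemLp u p volume ∧
    ∀ g : Z n, ∫ x, u x * (g : 𝓢(Eu n, ℂ)) x = T g), eLpNorm u p volume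

/-! ### The fractional heat semigroup -/

/-- Multiplication of the Fourier transform by a symbol of moderate growth, as an operator
on `𝒵(ℝⁿ)`. -/
noncomputable def multiplier {n : ℕ} (m : Eu n → ℂ) (hm : Moderate m) : Z n →ₗ[ℂ] Z n where
  toFun g := ⟨𝓕⁻ (FlatAtZero.toSchwartz (fun ξ => m ξ * (𝓕 (g : 𝓢(Eu n, ℂ)) : 𝓢(Eu n, ℂ)) ξ)
      (FlatAtZero.moderate_mul hm (flat_of_iteratedFDeriv_eq_zero _ g.2))), by
    intro k
    rw [FourierTransform.fourier_fourierInv_eq]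
    exact (FlatAtZero.contDiff_nat k
      (FlatAtZero.moderate_mul hm (flat_of_iteratedFDeriv_eq_zero _ g.2))).2⟩
  map_add' a b := by
    apply Subtype.ext
    simp only [Submodule.coe_add]
    rw [← FourierTransform.fourierInv_add]
    congr 1
    ext ξ
    simp only [FlatAtZero.toSchwartz, FourierTransform.fourier_add]
    exact mul_add _ _ _
  map_smul' c a := by
    apply Subtype.ext
    simp only [Submodule.coe_smul, RingHom.id_apply]
    rw [← FourierTransform.fourierInv_smul]
    congr 1
    ext ξ
    simp only [FlatAtZero.toSchwartz, FourierTransform.fourier_smul]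
    exact mul_left_comm _ _ _

/-- The symbol `exp (-t |ξ| ^ (2α))` of the semigroup, for times `t ≥ 0`, in Mathlib's frequency
variable. Negative times are not used (they are read as `t = 0`). -/
noncomputable def heatSymbol {n : ℕ} (α t : ℝ) (ξ : Eu n) : ℂ :=
  (Real.exp (-(max t 0) * ‖(2 * Real.pi) • ξ‖ ^ (2 * α)) : ℝ)

theorem moderate_heatSymbol {n : ℕ} (α t : ℝ) : Moderate (heatSymbol (n := n) α t) := by
  have h := moderate_exp_neg (E := Eu n) (c := max t 0 * (2 * Real.pi) ^ (2 * α))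
    (by positivity) α
  have e : heatSymbol (n := n) α t = fun ξ : Eu n =>
      ((Real.exp (-(max t 0 * (2 * Real.pi) ^ (2 * α)) * (‖ξ‖ ^ 2) ^ α) : ℝ) : ℂ) := by
    funext ξ
    rw [heatSymbol, norm_smul, Real.norm_of_nonneg (by positivity),
      Real.mul_rpow (by positivity) (norm_nonneg _), Real.rpow_mul (norm_nonneg ξ),
      Real.rpow_two, neg_mul, neg_mul, mul_assoc]
  rw [e]
  exact h

/-- `S_α(t) = exp (-t (-Δ) ^ α)` acting on `𝒵'(ℝⁿ)`: since the symbol is even, it is the transpose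
of the Fourier multiplier with symbol `exp (-t |ξ| ^ (2α))` on `𝒵(ℝⁿ)`. -/
noncomputable def heat {n : ℕ} (α t : ℝ) (f : ZDual n) : Z n →ₗ[ℂ] ℂ :=
  f.toLinearMap ∘ₗ multiplier (heatSymbol α t) (moderate_heatSymbol α t)

/-- The quantity `(∫₀^∞ (t ^ (-s / (2α)) ‖S_α(t) f‖_p) ^ q dt / t) ^ (1 / q)`, and
`sup_{t > 0} t ^ (-s / (2α)) ‖S_α(t) f‖_p` if `q = ∞`. -/
noncomputable def heatNorm {n : ℕ} (α s : ℝ) (p q : ℝ≥0∞) (f : ZDual n) : ℝ≥0∞ :=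
  if q = ⊤ then
    ⨆ (t : ℝ) (_ : 0 < t), ENNReal.ofReal (t ^ (-s / (2 * α))) * distNorm p (heat α t f)
  else
    (∫⁻ t in Ioi (0 : ℝ), (ENNReal.ofReal (t ^ (-s / (2 * α))) * distNorm p (heat α t f)) ^ q.toReal
      * ENNReal.ofReal (1 / t)) ^ (1 / q.toReal)

/-! ### Homogeneous Besov spaces -/

/-- The radial bump functions `ψ̂` from which the dyadic decomposition is built. -/
structure Cutoff (n : ℕ) where
  /-- the function `ψ̂` -/
  toFun : Eu n → ℝ
  smooth : ContDiff ℝ ∞ toFun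
  radial : ∀ ξ η, ‖ξ‖ = ‖η‖ → toFun ξ = toFun η
  nonneg : ∀ ξ, 0 ≤ toFun ξ
  le_one : ∀ ξ, toFun ξ ≤ 1
  eq_one : ∀ ξ, ‖ξ‖ ≤ 1 → toFun ξ = 1
  eq_zero : ∀ ξ, 2 ≤ ‖ξ‖ → toFun ξ = 0

namespace Cutoff

variable {n : ℕ} (ψ : Cutoff n)

/-- `φ̂(ξ) = ψ̂(ξ) - ψ̂(2ξ)`. -/
noncomputable def phiHat (ξ : Eu n) : ℝ := ψ.toFun ξ - ψ.toFun ((2 : ℝ) • ξ)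

/-- `φ̂_j(ξ) = φ̂(2^{-j} ξ)`. -/
noncomputable def phiHatJ (j : ℤ) (ξ : Eu n) : ℝ := ψ.phiHat ((2 : ℝ) ^ (-j) • ξ)

theorem phiHatJ_eq_zero_of_le (j : ℤ) {ξ : Eu n} (h : 2 * (2 : ℝ) ^ j ≤ ‖ξ‖) :
    ψ.phiHatJ j ξ = 0 := by
  have h2 : 2 ≤ ‖(2 : ℝ) ^ (-j) • ξ‖ := by
    rw [norm_smul, Real.norm_of_nonneg (by positivity), zpow_neg, ← div_eq_inv_mul,
      le_div_iff₀ (by positivity)]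
    exact h
  rw [phiHatJ, phiHat, ψ.eq_zero _ h2, ψ.eq_zero, sub_zero]
  rw [norm_smul, Real.norm_of_nonneg (by norm_num)]
  linarith

theorem phiHatJ_eq_zero_of_ge (j : ℤ) {ξ : Eu n} (h : 2 * ‖ξ‖ ≤ (2 : ℝ) ^ j) :
    ψ.phiHatJ j ξ = 0 := by
  have h2 : 2 * ‖(2 : ℝ) ^ (-j) • ξ‖ ≤ 1 := by
    rw [norm_smul, Real.norm_of_nonneg (by positivity), zpow_neg, mul_left_comm,
      inv_mul_le_iff₀ (by positivity)]
    linarith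
  have h3 := norm_nonneg ((2 : ℝ) ^ (-j) • ξ)
  rw [phiHatJ, phiHat, ψ.eq_one _ (by linarith), ψ.eq_one, sub_self]
  rw [norm_smul, Real.norm_of_nonneg (by norm_num)]
  exact h2

theorem hasCompactSupport_phiHatJ (j : ℤ) :
    HasCompactSupport fun ξ : Eu n => (ψ.phiHatJ j ((2 * Real.pi) • ξ) : ℂ) := by
  refine HasCompactSupport.intro (isCompact_closedBall 0 ((2 * (2 : ℝ) ^ j) / (2 * Real.pi)))
    fun ξ hξ => ?_
  rw [ψ.phiHatJ_eq_zero_of_le, Complex.ofReal_zero]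
  rw [norm_smul, Real.norm_of_nonneg (by positivity)]
  rw [mem_closedBall_zero_iff, not_le, div_lt_iff₀ (by positivity)] at hξ
  linarith

theorem contDiff_phiHatJ (j : ℤ) :
    ContDiff ℝ ∞ fun ξ : Eu n => (ψ.phiHatJ j ((2 * Real.pi) • ξ) : ℂ) := by
  have h := ψ.smooth
  refine Complex.ofRealCLM.contDiff.comp ?_
  exact (h.comp (contDiff_const_smul _ |>.comp (contDiff_const_smul _))).sub
    (h.comp ((contDiff_const_smul _).comp ((contDiff_const_smul _).comp (contDiff_const_smul _))))

/-- The kernel `φ_j` of the dyadic block: the Schwartz function whose Fourier transform is `φ̂_j`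
(normalised such that convolution with `φ_j` multiplies the Fourier transform by `φ̂_j`). -/
noncomputable def kernel (j : ℤ) : 𝓢(Eu n, ℂ) :=
  𝓕⁻ ((ψ.hasCompactSupport_phiHatJ j).toSchwartzMap (ψ.contDiff_phiHatJ j))

/-- The Schwartz function `y ↦ φ_j(x - y)`. -/
noncomputable def translate (j : ℤ) (x : Eu n) : 𝓢(Eu n, ℂ) :=
  SchwartzMap.compSubConstCLM ℂ x
    (SchwartzMap.compCLMOfContinuousLinearEquiv ℂ (ContinuousLinearEquiv.neg ℝ) (ψ.kernel j))

theorem translate_apply (j : ℤ) (x y : Eu n) : ψ.translate j x y = ψ.kernel j (x - y) := by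
  simp [translate]

theorem fourier_translate (j : ℤ) (x ξ : Eu n) :
    (𝓕 (ψ.translate j x) : 𝓢(Eu n, ℂ)) ξ
      = Real.fourierChar (-inner ℝ x ξ) • (ψ.phiHatJ j ((2 * Real.pi) • (-ξ)) : ℂ) := by
  have h : (ψ.phiHatJ j ((2 * Real.pi) • (-ξ)) : ℂ) = (𝓕 (ψ.kernel j) : 𝓢(Eu n, ℂ)) (-ξ) := by
    rw [kernel, FourierTransform.fourier_fourierInv_eq]
    rfl
  rw [h, SchwartzMap.fourier_coe, SchwartzMap.fourier_coe, Real.fourier_eq, Real.fourier_eq,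
    ← integral_sub_left_eq_self _ volume x, Circle.smul_def, ← integral_smul]
  congr 1 with y
  rw [translate_apply, sub_sub_cancel, inner_sub_left, inner_neg_right,
    show -(inner ℝ x ξ - inner ℝ y ξ) = -inner ℝ x ξ + - -inner ℝ y ξ by ring,
    AddChar.map_add_eq_mul, mul_smul, Circle.smul_def]

theorem translate_mem (j : ℤ) (x : Eu n) : ψ.translate j x ∈ Z n := by
  intro k
  have h : ((𝓕 (ψ.translate j x) : 𝓢(Eu n, ℂ)) : Eu n → ℂ) =ᶠ[nhds 0] fun _ => 0 := by
    have hr : 0 < (2 : ℝ) ^ j / (4 * Real.pi) := by positivity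
    filter_upwards [Metric.closedBall_mem_nhds (0 : Eu n) hr] with ξ hξ
    rw [mem_closedBall_zero_iff, le_div_iff₀ (by positivity)] at hξ
    rw [fourier_translate, ψ.phiHatJ_eq_zero_of_ge, Complex.ofReal_zero, smul_zero]
    rw [norm_smul, norm_neg, Real.norm_of_nonneg (by positivity)]
    linarith
  rw [(h.iteratedFDeriv ℝ k).eq_of_nhds, iteratedFDeriv_fun_zero]
  rfl

/-- The dyadic block `Δ_j f = φ_j * f` of `f ∈ 𝒵'(ℝⁿ)`, the function `x ↦ ⟨f, φ_j(x - ·)⟩`. -/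
noncomputable def block (j : ℤ) (f : ZDual n) (x : Eu n) : ℂ :=
  f ⟨ψ.translate j x, ψ.translate_mem j x⟩

/-- The homogeneous Besov norm `(∑_j (2^{js} ‖φ_j * f‖_p) ^ q) ^ (1 / q)`, and
`sup_j 2^{js} ‖φ_j * f‖_p` if `q = ∞`. -/
noncomputable def besovNorm (s : ℝ) (p q : ℝ≥0∞) (f : ZDual n) : ℝ≥0∞ :=
  if q = ⊤ then
    ⨆ j : ℤ, ENNReal.ofReal ((2 : ℝ) ^ (j * s)) * eLpNorm (ψ.block j f) p volume
  else
    (∑' j : ℤ, (ENNReal.ofReal ((2 : ℝ) ^ (j * s)) * eLpNorm (ψ.block j f) p volume) ^ q.toReal)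
      ^ (1 / q.toReal)

/-- The homogeneous Besov space `Ḃ^s_{p,q}(ℝⁿ)`. -/
def besovSpace (s : ℝ) (p q : ℝ≥0∞) : Set (ZDual n) :=
  {f | ψ.besovNorm s p q f < ⊤}

end Cutoff

end FracHeat

namespace FracHeat

open MeasureTheory Set Filter Topology
open scoped SchwartzMap FourierTransform ENNReal NNReal ContDiff BoundedContinuousFunction

/-! ### Schur's test and Young's inequality -/

/-! On the annulus `|ξ| ∼ 2^j` the heat symbol `exp (-t|ξ|^{2α})` behaves like a function of the
single parameter `τ = t·2^{2αj}`. Dilating the annulus to unit size turns it into `exp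
(-τ|ξ|^{2α})`, and dilation preserves the `L¹` norm of a convolution kernel. Bounding finitely many
derivatives on the fixed annulus gives two estimates: localised to the annulus, the heat kernel has
`L¹` norm `≲ min(1, τ^{-M})` for any `M` (`exists_heat_kernel`), and the kernel of the inverse `exp
(t|ξ|^{2α})` is bounded in `L¹` as long as `τ` stays bounded (`exists_inverse_heat_kernel`).

From heat to Besov: Young's inequality with the inverse kernel gives `‖Δ_j f‖_p ≤ C ‖S_α(t) f‖_p`
whenever `t·2^{2αj}` is bounded (`exists_eLpNorm_block_le`). Taking `t ∼ 2^{-2αj}` and integrating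
over this dyadic interval, whose `dt/t` measure is comparable to `1`, bounds the dyadic sum by the
integral.

From Besov to heat: the dyadic blocks sum to the identity on `𝒵`, because the remainder lives where
the Fourier transform of an element of `𝒵` is tiny, near `0` and near `∞` (`tendsto_sum_dyadic`).
Hence `‖S_α(t) f‖_p ≤ C ∑_j min(1, τ_j^{-M}) ‖Δ_j f‖_p`, where `τ_j = t·2^{2αj}`
(`distNorm_heat_le`). With the weights included and `a = -s/(2α)`, the coefficient is `τ_j^a min(1,
τ_j^{-M})`. It decays geometrically on both sides of `τ_j = 1`: for small `τ_j` because `s < 0`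
makes `a > 0`, for large `τ_j` because `M ≥ 2a`. Young's inequality `ℓ¹ * ℓ^q ⊆ ℓ^q` finishes.

The remaining work is to justify convolution identities for a functional `f` on `𝒵`, namely `∫ h(y)
f(η(· - y)) dy = f(h * η)` (`integral_functional_shift`). There `f` is factored through a finite
product of Banach spaces, in which the Bochner integral is available. -/

/-- Hölder applied to the splitting `k u = k^{1/q} · (k^{1/p} u)` with conjugate exponents. -/
theorem rpow_lintegral_mul_le {β : Type*} [MeasurableSpace β] {ν : Measure β} {k u : β → ℝ≥0∞}
    (hk : AEMeasurable k ν) (hu : AEMeasurable u ν) {p : ℝ} (hp : 1 ≤ p) :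
    (∫⁻ y, k y * u y ∂ν) ^ p ≤ (∫⁻ y, k y ∂ν) ^ (p - 1) * ∫⁻ y, k y * u y ^ p ∂ν := by
  rcases hp.eq_or_lt with rfl | hp
  · simp
  have hpq := Real.HolderConjugate.conjExponent hp
  set q := p.conjExponent
  have hp0 : 0 < p := by linarith
  have hq0 : 0 < q := hpq.symm.pos
  have h1 : 1 / q + 1 / p = 1 := by
    have := hpq.inv_add_inv_eq_one
    rw [one_div, one_div]; linarith
  have e : ∀ y, k y * u y = ((fun y => k y ^ (1 / q)) * fun y => k y ^ (1 / p) * u y) y := by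
    intro y
    simp only [Pi.mul_apply]
    rw [← mul_assoc, ← ENNReal.rpow_add_of_nonneg _ _ (by positivity) (by positivity), h1,
      ENNReal.rpow_one]
  simp_rw [e]
  have h := ENNReal.lintegral_mul_le_Lp_mul_Lq ν hpq.symm (hk.pow_const (1 / q))
    ((hk.pow_const (1 / p)).mul hu)
  refine (ENNReal.rpow_le_rpow h hp0.le).trans (le_of_eq ?_)
  rw [ENNReal.mul_rpow_of_nonneg _ _ hp0.le, ← ENNReal.rpow_mul, ← ENNReal.rpow_mul,
    one_div_mul_cancel hp0.ne', ENNReal.rpow_one]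
  congr 1
  · congr 1
    · refine lintegral_congr fun y => ?_
      rw [← ENNReal.rpow_mul, one_div_mul_cancel hq0.ne', ENNReal.rpow_one]
    · have : p * (1 / q + 1 / p) = p := by rw [h1, mul_one]
      rw [mul_add, mul_one_div_cancel hp0.ne'] at this
      linarith
  · refine lintegral_congr fun y => ?_
    simp only [Pi.mul_apply]
    rw [ENNReal.mul_rpow_of_nonneg _ _ hp0.le, ← ENNReal.rpow_mul,
      one_div_mul_cancel hp0.ne', ENNReal.rpow_one]

/-- Schur's test with a common bound for rows and columns: Hölder against the measure `K x y dν(y)`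
uses the row bound, Tonelli then uses the column bound. It serves twice, for convolutions on `ℝⁿ`
and, with counting measure, for sequences. -/
theorem lintegral_schur {α β : Type*} [MeasurableSpace α] [MeasurableSpace β] {μ : Measure α}
    {ν : Measure β} [SFinite μ] [SFinite ν] {K : α → β → ℝ≥0∞}
    (hK : Measurable (Function.uncurry K)) {u : β → ℝ≥0∞} (hu : AEMeasurable u ν) {A : ℝ≥0∞}
    (h1 : ∀ x, ∫⁻ y, K x y ∂ν ≤ A) (h2 : ∀ y, ∫⁻ x, K x y ∂μ ≤ A) {p : ℝ} (hp : 1 ≤ p) :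
    ∫⁻ x, (∫⁻ y, K x y * u y ∂ν) ^ p ∂μ ≤ A ^ p * ∫⁻ y, u y ^ p ∂ν := by
  have hp1 : 0 ≤ p - 1 := by linarith
  calc _ ≤ ∫⁻ x, A ^ (p - 1) * ∫⁻ y, K x y * u y ^ p ∂ν ∂μ := by
        refine lintegral_mono fun x => ?_
        refine (rpow_lintegral_mul_le (by fun_prop) hu hp).trans ?_
        gcongr
        exact h1 x
    _ ≤ A ^ (p - 1) * ∫⁻ x, ∫⁻ y, K x y * u y ^ p ∂ν ∂μ := by
        -- A finite constant leaves the integral without measurability; `A = ⊤` needs it, except for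
        -- `p = 1`, where `A ^ (p - 1) = 1`.
        rcases eq_or_ne A ⊤ with rfl | hA
        · rcases hp1.eq_or_lt with h0 | h0
          · simp [← h0]
          · rw [ENNReal.top_rpow_of_pos h0, lintegral_const_mul'']
            exact (AEMeasurable.lintegral_prod_right'
              (f := fun z : α × β => K z.1 z.2 * u z.2 ^ p)
              (hK.aemeasurable.mul (hu.comp_snd.pow_const p)))
        · rw [lintegral_const_mul' _ _ (ENNReal.rpow_ne_top_of_nonneg hp1 hA)]
    _ = A ^ (p - 1) * ∫⁻ y, (∫⁻ x, K x y ∂μ) * u y ^ p ∂ν := by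
        rw [lintegral_lintegral_swap]
        · congr 1
          refine lintegral_congr fun y => ?_
          rw [lintegral_mul_const _ (by fun_prop)]
        · exact hK.aemeasurable.mul (hu.comp_snd.pow_const p)
    _ ≤ A ^ (p - 1) * ∫⁻ y, A * u y ^ p ∂ν := by
        gcongr with y
        exact h2 y
    _ = A ^ p * ∫⁻ y, u y ^ p ∂ν := by
        rw [lintegral_const_mul'' _ (hu.pow_const p), ← mul_assoc]
        congr 1
        conv_lhs => rw [← ENNReal.rpow_one A, ← ENNReal.rpow_mul, one_mul]
        rw [← ENNReal.rpow_add_of_nonneg _ _ hp1 zero_le_one, sub_add_cancel]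

theorem eLpNorm_convolution_le {n : ℕ} {k u : Eu n → ℂ} (hk : Continuous k)
    (hu : AEStronglyMeasurable u volume) {p : ℝ≥0∞} (hp : 1 ≤ p) :
    eLpNorm (fun x => ∫ y, k (x - y) * u y) p volume
      ≤ eLpNorm k 1 volume * eLpNorm u p volume := by
  have hk1 : ∀ x, ∫⁻ y, ‖k (x - y)‖ₑ = eLpNorm k 1 volume := fun x => by
    rw [eLpNorm_one_eq_lintegral_enorm]
    exact lintegral_sub_left_eq_self (fun y => ‖k y‖ₑ) x
  have hk2 : ∀ y, ∫⁻ x, ‖k (x - y)‖ₑ = eLpNorm k 1 volume := fun y => by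
    rw [eLpNorm_one_eq_lintegral_enorm]
    exact lintegral_sub_right_eq_self (fun y => ‖k y‖ₑ) y
  have hb : ∀ x, ‖∫ y, k (x - y) * u y‖ₑ ≤ ∫⁻ y, ‖k (x - y)‖ₑ * ‖u y‖ₑ := fun x => by
    refine (enorm_integral_le_lintegral_enorm _).trans (le_of_eq ?_)
    simp only [enorm_mul]
  rcases eq_or_ne p ⊤ with rfl | hpt
  · rw [eLpNorm_exponent_top, eLpNorm_exponent_top]
    refine eLpNormEssSup_le_of_ae_enorm_bound (Eventually.of_forall fun x => (hb x).trans ?_)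
    have hm : Measurable fun y => ‖k (x - y)‖ₑ :=
      (hk.comp (continuous_const.sub continuous_id)).enorm.measurable
    rw [← hk1 x, ← lintegral_mul_const _ hm]
    refine lintegral_mono_ae ?_
    filter_upwards [enorm_ae_le_eLpNormEssSup u volume] with y hy
    gcongr
  · have hp0 : p ≠ 0 := fun h => by simp [h] at hp
    have hpr : 1 ≤ p.toReal := by
      rw [← ENNReal.toReal_one]; exact ENNReal.toReal_mono hpt hp
    rw [eLpNorm_eq_lintegral_rpow_enorm_toReal hp0 hpt,
      eLpNorm_eq_lintegral_rpow_enorm_toReal (f := u) hp0 hpt]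
    have hS := lintegral_schur (μ := volume) (ν := volume)
      (K := fun x y : Eu n => ‖k (x - y)‖ₑ) (u := fun y => ‖u y‖ₑ)
      (hk.comp (by fun_prop : Continuous fun z : Eu n × Eu n => z.1 - z.2)).enorm.measurable hu.enorm
      (fun x => (hk1 x).le) (fun y => (hk2 y).le) hpr
    have hle : ∫⁻ x, ‖∫ y, k (x - y) * u y‖ₑ ^ p.toReal
        ≤ eLpNorm k 1 volume ^ p.toReal * ∫⁻ y, ‖u y‖ₑ ^ p.toReal :=
      (lintegral_mono fun x => ENNReal.rpow_le_rpow (hb x) (by linarith)).trans hS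
    refine (ENNReal.rpow_le_rpow hle (by positivity)).trans (le_of_eq ?_)
    rw [ENNReal.mul_rpow_of_nonneg _ _ (by positivity), ← ENNReal.rpow_mul,
      mul_one_div_cancel (by linarith), ENNReal.rpow_one]

/-! ### Integrable kernels of multipliers supported in an annulus -/

/-- The `L¹` norm is a continuous seminorm on `𝒮` and the inverse Fourier transform is continuous
there, so finitely many Schwartz seminorms of the symbol suffice. -/
theorem exists_eLpNorm_one_fourierInv_le (n : ℕ) :
    ∃ (s : Finset (ℕ × ℕ)) (C : ℝ≥0), ∀ m : 𝓢(Eu n, ℂ),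
      eLpNorm (𝓕⁻ m : 𝓢(Eu n, ℂ)) 1 volume
        ≤ C * ENNReal.ofReal (s.sup (schwartzSeminormFamily ℂ (Eu n) ℂ) m) := by
  obtain ⟨k, C, hC⟩ := SchwartzMap.eLpNorm_le_seminorm (E := Eu n) ℂ ℂ 1 volume
  set q : Seminorm ℂ 𝓢(Eu n, ℂ) :=
    ((Finset.Iic (k, 0)).sup (schwartzSeminormFamily ℂ (Eu n) ℂ)).comp
      (FourierTransform.fourierInvCLM ℂ 𝓢(Eu n, ℂ)).toLinearMap with hq
  have hqc : Continuous q := by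
    have h1 : Continuous
        ((Finset.Iic (k, 0)).sup (schwartzSeminormFamily ℂ (Eu n) ℂ) : Seminorm ℂ 𝓢(Eu n, ℂ)) :=
      Seminorm.continuous_finsetSup fun i _ =>
        (schwartz_withSeminorms ℂ (Eu n) ℂ).continuous_seminorm i
    exact h1.comp (FourierTransform.fourierInvCLM ℂ 𝓢(Eu n, ℂ)).continuous
  obtain ⟨s, D, -, hD⟩ := Seminorm.bound_of_continuous (schwartz_withSeminorms ℂ _ _) q hqc
  refine ⟨s, C * D, fun m => (hC _).trans ?_⟩
  rw [ENNReal.coe_mul, mul_assoc, ← ENNReal.ofReal_coe_nnreal (p := D),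
    ← ENNReal.ofReal_mul (NNReal.coe_nonneg D)]
  gcongr
  exact hD m

theorem moderate_rpow_norm (n : ℕ) (α : ℝ) :
    Moderate (fun ξ : Eu n => ‖(2 * Real.pi) • ξ‖ ^ (2 * α)) := by
  have h := moderate_norm_rpow (E := Eu n) ((2 * Real.pi) ^ (2 * α)) α
  have e : (fun ξ : Eu n => ‖(2 * Real.pi) • ξ‖ ^ (2 * α))
      = fun ξ => (2 * Real.pi) ^ (2 * α) * (‖ξ‖ ^ 2) ^ α := by
    funext ξ
    rw [norm_smul, Real.norm_of_nonneg (by positivity),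
      Real.mul_rpow (by positivity) (norm_nonneg _), Real.rpow_mul (norm_nonneg ξ), Real.rpow_two]
  rw [e]
  exact h

theorem weight_le {E : Type*} [NormedAddCommGroup E] {r R : ℝ} (hr : 0 < r) {x : E}
    (h1 : r ≤ ‖x‖) (h2 : ‖x‖ ≤ R) : weight x ≤ R + r⁻¹ := by
  unfold weight
  gcongr

/-- Faà di Bruno's estimate: on the annulus the weight is at most `|R| + r⁻¹`, so the derivatives of
`P` are bounded there. The point is that `C` does not depend on `g`. -/
theorem Moderate.norm_iteratedFDeriv_comp_le {E F : Type} [NormedAddCommGroup E]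
    [NormedSpace ℝ E] [NormedAddCommGroup F] [NormedSpace ℝ F] {P : E → ℝ} (hP : Moderate P)
    {r : ℝ} (hr : 0 < r) (R : ℝ) (l : ℕ) :
    ∃ C : ℝ, 0 ≤ C ∧ ∀ g : ℝ → F, ContDiff ℝ ∞ g → ∀ (B : ℝ) (x : E), r ≤ ‖x‖ → ‖x‖ ≤ R →
      (∀ i ≤ l, ‖iteratedFDeriv ℝ i g (P x)‖ ≤ B) →
        ‖iteratedFDeriv ℝ l (fun x => g (P x)) x‖ ≤ C * B := by
  choose A M hA using hP.2
  set W : ℝ := |R| + r⁻¹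
  have hW : 0 ≤ W := by positivity
  -- The summand `1` gives `D ≤ D ^ i` for `i ≥ 1`, the form in which the composition estimate wants
  -- its hypothesis.
  set D : ℝ := 1 + ∑ i ∈ Finset.range (l + 1), |A i| * W ^ M i
  have hD1 : 1 ≤ D := le_add_of_nonneg_right (Finset.sum_nonneg fun _ _ => by positivity)
  refine ⟨l.factorial * D ^ l, by positivity, fun g hg B x h1 h2 hB => ?_⟩
  have hx : x ≠ 0 := norm_pos_iff.1 (hr.trans_le h1)
  have ho : IsOpen ({0}ᶜ : Set E) := isOpen_compl_singleton
  have hxo : x ∈ ({0}ᶜ : Set E) := hx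
  have h := norm_iteratedFDerivWithin_comp_le (𝕜 := ℝ) (g := g) (f := P) (n := l) (s := {0}ᶜ)
    (t := univ) (x := x) (N := ∞) hg.contDiffOn (fun y hy => (hP.1 y hy).contDiffWithinAt)
    (by exact_mod_cast le_top) uniqueDiffOn_univ ho.uniqueDiffOn (fun _ _ => mem_univ _) hxo
    (C := B) (D := D) (fun i hi => by rw [iteratedFDerivWithin_univ]; exact hB i hi) ?_
  · rw [iteratedFDerivWithin_of_isOpen _ ho hxo] at h
    refine h.trans (le_of_eq ?_)
    ring
  · intro i hi1 hi
    rw [iteratedFDerivWithin_of_isOpen _ ho hxo]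
    have hmem : i ∈ Finset.range (l + 1) := Finset.mem_range.2 (by omega)
    have hw : weight x ≤ W := weight_le hr h1 (h2.trans (le_abs_self R))
    have h3 : A i * weight x ^ M i ≤ |A i| * W ^ M i := by
      have := weight_nonneg x
      gcongr
      exact le_abs_self _
    have h4 : |A i| * W ^ M i ≤ D :=
      (Finset.single_le_sum (f := fun i => |A i| * W ^ M i)
        (fun _ _ => by positivity) hmem).trans (le_add_of_nonneg_left zero_le_one)
    exact ((hA i x hx).trans (h3.trans h4)).trans (le_self_pow₀ hD1 (by omega))

/-- The constants depend on the cutoff `χ` and on `P` only. The function `g` carries the parameter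
`τ`, so uniform kernel bounds reduce to one-variable bounds on the derivatives of exponentials. -/
theorem exists_kernel {n : ℕ} {P : Eu n → ℝ} (hP : Moderate P) (χ : 𝓢(Eu n, ℂ)) {r R : ℝ}
    (hr : 0 < r) (hχ : ∀ x, χ x ≠ 0 → r ≤ ‖x‖ ∧ ‖x‖ ≤ R) :
    ∃ (C : ℝ≥0) (N : ℕ), ∀ g : ℝ → ℂ, ContDiff ℝ ∞ g → ∀ B : ℝ≥0,
      (∀ i ≤ N, ∀ x, r ≤ ‖x‖ → ‖x‖ ≤ R → ‖iteratedFDeriv ℝ i g (P x)‖ ≤ B) →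
      ∃ k : 𝓢(Eu n, ℂ), (∀ ξ, (𝓕 k : 𝓢(Eu n, ℂ)) ξ = χ ξ * g (P ξ)) ∧
        eLpNorm k 1 volume ≤ C * B := by
  obtain ⟨s, C₀, hC₀⟩ := exists_eLpNorm_one_fourierInv_le n
  choose c hc0 hc using fun l : ℕ => hP.norm_iteratedFDeriv_comp_le (F := ℂ) hr R l
  have hχs : tsupport χ ⊆ {x | r ≤ ‖x‖ ∧ ‖x‖ ≤ R} := by
    refine closure_minimal (fun x hx => hχ x hx) ?_
    exact (isClosed_le continuous_const continuous_norm).inter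
      (isClosed_le continuous_norm continuous_const)
  have hχc : HasCompactSupport χ := by
    refine (isCompact_closedBall (0 : Eu n) R).of_isClosed_subset (isClosed_tsupport _) ?_
    exact fun x hx => by simpa using (hχs hx).2
  set b : ℕ × ℕ → ℝ := fun i => |R| ^ i.1 * ∑ j ∈ Finset.range (i.2 + 1),
    (i.2.choose j : ℝ) * SchwartzMap.seminorm ℂ 0 j χ * c (i.2 - j) with hb
  have hb0 : ∀ i, 0 ≤ b i := fun i => by
    refine mul_nonneg (by positivity) (Finset.sum_nonneg fun j _ => ?_)
    have := hc0 (i.2 - j)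
    positivity
  refine ⟨C₀ * (∑ i ∈ s, b i).toNNReal, s.sup Prod.snd, fun g hg B hB => ?_⟩
  have hsm : ContDiff ℝ ∞ fun ξ => χ ξ * g (P ξ) := by
    rw [contDiff_iff_contDiffAt]
    intro x
    by_cases hx : x ∈ tsupport χ
    · have hx0 : x ≠ 0 := norm_pos_iff.1 (hr.trans_le (hχs hx).1)
      exact (χ.smooth ⊤).contDiffAt.mul (hg.contDiffAt.comp x (hP.1 x hx0))
    · have : (fun ξ => χ ξ * g (P ξ)) =ᶠ[𝓝 x] fun _ => 0 := by
        filter_upwards [notMem_tsupport_iff_eventuallyEq.1 hx] with y hy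
        simp [hy]
      exact contDiffAt_const.congr_of_eventuallyEq this
  have hcs : HasCompactSupport fun ξ => χ ξ * g (P ξ) := hχc.mul_right
  set m : 𝓢(Eu n, ℂ) := hcs.toSchwartzMap hsm with hm
  have hmv : ∀ ξ, m ξ = χ ξ * g (P ξ) := fun ξ => rfl
  have hsem : ∀ i ∈ s, SchwartzMap.seminorm ℂ i.1 i.2 m ≤ b i * B := by
    intro i hi
    refine SchwartzMap.seminorm_le_bound ℂ _ _ _ (mul_nonneg (hb0 i) B.2) fun x => ?_
    by_cases hx : x ∈ tsupport χ
    · obtain ⟨h1, h2⟩ := hχs hx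
      have hx0 : x ≠ 0 := norm_pos_iff.1 (hr.trans_le h1)
      have ho : IsOpen ({0}ᶜ : Set (Eu n)) := isOpen_compl_singleton
      have hxo : x ∈ ({0}ᶜ : Set (Eu n)) := hx0
      have h := norm_iteratedFDerivWithin_mul_le (𝕜 := ℝ) (A := ℂ) (f := χ)
        (g := fun x => g (P x)) (s := {0}ᶜ)
        (N := ∞) (n := i.2) (χ.smooth ⊤).contDiffOn
        (fun y hy => (hg.contDiffAt.comp y (hP.1 y hy)).contDiffWithinAt) ho.uniqueDiffOn
        (x := x) hxo (by exact_mod_cast le_top)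
      simp only [iteratedFDerivWithin_of_isOpen _ ho hxo] at h
      have hx' : ‖x‖ ≤ |R| := h2.trans (le_abs_self R)
      have h' : ‖iteratedFDeriv ℝ i.2 m x‖ ≤ (∑ j ∈ Finset.range (i.2 + 1),
          (i.2.choose j : ℝ) * SchwartzMap.seminorm ℂ 0 j χ * c (i.2 - j)) * B := by
        refine h.trans ?_
        rw [Finset.sum_mul]
        refine Finset.sum_le_sum fun j _ => ?_
        rw [mul_assoc _ (c (i.2 - j))]
        gcongr
        · exact χ.norm_iteratedFDeriv_le_seminorm ℂ j x
        · refine hc _ g hg B x h1 h2 fun l hl => hB l ?_ x h1 h2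
          have := Finset.le_sup (f := Prod.snd) hi
          omega
      calc _ ≤ |R| ^ i.1 * ((∑ j ∈ Finset.range (i.2 + 1),
          (i.2.choose j : ℝ) * SchwartzMap.seminorm ℂ 0 j χ * c (i.2 - j)) * B) := by gcongr
        _ = b i * B := by rw [hb]; ring
    · have : (m : Eu n → ℂ) =ᶠ[𝓝 x] fun _ => 0 := by
        filter_upwards [notMem_tsupport_iff_eventuallyEq.1 hx] with y hy
        simp [hmv, hy]
      rw [(this.iteratedFDeriv ℝ i.2).eq_of_nhds, iteratedFDeriv_fun_zero]
      simpa using mul_nonneg (hb0 i) B.2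
  refine ⟨𝓕⁻ m, fun ξ => by rw [FourierTransform.fourier_fourierInv_eq, hmv], ?_⟩
  refine (hC₀ m).trans ?_
  rw [ENNReal.coe_mul, mul_assoc]
  gcongr
  have hS : 0 ≤ ∑ i ∈ s, b i := Finset.sum_nonneg fun i _ => hb0 i
  rw [← ENNReal.ofReal_coe_nnreal (p := B), ← ENNReal.ofReal, ← ENNReal.ofReal_mul hS]
  refine ENNReal.ofReal_le_ofReal ?_
  refine Seminorm.finset_sup_apply_le (mul_nonneg hS B.2) fun i hi => (hsem i hi).trans ?_
  exact mul_le_mul_of_nonneg_right (Finset.single_le_sum (fun i _ => hb0 i) hi) B.2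

/-- The witness is `k' = c^n k(c ·)`, the dilation that preserves the `L¹` norm. -/
theorem exists_dilate_kernel {n : ℕ} (k : 𝓢(Eu n, ℂ)) {c : ℝ} (hc : 0 < c) :
    ∃ k' : 𝓢(Eu n, ℂ), (∀ ξ, (𝓕 k' : 𝓢(Eu n, ℂ)) ξ = (𝓕 k : 𝓢(Eu n, ℂ)) (c⁻¹ • ξ)) ∧
      eLpNorm k' 1 volume = eLpNorm k 1 volume := by
  set e : Eu n ≃L[ℝ] Eu n := ContinuousLinearEquiv.smulLeft (Units.mk0 c hc.ne')
  set k₀ : 𝓢(Eu n, ℂ) := SchwartzMap.compCLMOfContinuousLinearEquiv ℂ e k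
  have hk₀ : ∀ x, k₀ x = k (c • x) := fun x => rfl
  have hfr : Module.finrank ℝ (Eu n) = n := by simp
  refine ⟨((c ^ n : ℝ) : ℂ) • k₀, fun ξ => ?_, ?_⟩
  · rw [FourierTransform.fourier_smul]
    simp only [smul_apply]
    rw [SchwartzMap.fourier_coe, SchwartzMap.fourier_coe, Real.fourier_eq, Real.fourier_eq]
    have h := Measure.integral_comp_smul (volume : Measure (Eu n))
      (fun v => Real.fourierChar (-inner ℝ v (c⁻¹ • ξ)) • k v) c
    rw [hfr, abs_of_nonneg (by positivity)] at h
    have h2 : ∀ v, Real.fourierChar (-inner ℝ (c • v) (c⁻¹ • ξ)) • k (c • v)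
        = Real.fourierChar (-inner ℝ v ξ) • k₀ v := fun v => by
      rw [hk₀, real_inner_smul_left, real_inner_smul_right, mul_inv_cancel_left₀ hc.ne']
    simp_rw [h2] at h
    rw [h, Complex.real_smul, smul_eq_mul, ← mul_assoc, ← Complex.ofReal_mul,
      mul_inv_cancel₀ (by positivity), Complex.ofReal_one, one_mul]
  · rw [eLpNorm_one_eq_lintegral_enorm, eLpNorm_one_eq_lintegral_enorm,
      ← ofReal_integral_norm_eq_lintegral_enorm (SchwartzMap.integrable _),
      ← ofReal_integral_norm_eq_lintegral_enorm (SchwartzMap.integrable _)]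
    congr 1
    have h := Measure.integral_comp_smul (volume : Measure (Eu n)) (fun v => ‖k v‖) c
    rw [hfr, abs_of_nonneg (by positivity)] at h
    simp only [smul_apply, norm_smul, hk₀]
    rw [integral_const_mul, h, smul_eq_mul, Complex.norm_real, Real.norm_of_nonneg (by positivity),
      mul_inv_cancel_left₀ (by positivity)]

/-! ### Heat factors and their inverses on a dyadic annulus -/

theorem contDiff_exp_mul (τ : ℝ) :
    ContDiff ℝ ∞ fun z : ℝ => ((Real.exp (τ * z) : ℝ) : ℂ) :=
  Complex.ofRealCLM.contDiff.comp (f := fun z : ℝ => Real.exp (τ * z)) (by fun_prop)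

theorem norm_iteratedFDeriv_exp_mul (τ : ℝ) (i : ℕ) (z : ℝ) :
    ‖iteratedFDeriv ℝ i (fun z : ℝ => ((Real.exp (τ * z) : ℝ) : ℂ)) z‖
      = |τ| ^ i * Real.exp (τ * z) := by
  have hc : ContDiff ℝ ∞ fun z : ℝ => Real.exp (τ * z) := by fun_prop
  have e : (fun z : ℝ => ((Real.exp (τ * z) : ℝ) : ℂ))
      = Complex.ofRealLI ∘ fun z => Real.exp (τ * z) := rfl
  rw [e, LinearIsometry.norm_iteratedFDeriv_comp_left _ hc.contDiffAt
    (by exact_mod_cast le_top), norm_iteratedFDeriv_eq_norm_iteratedDeriv,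
    iteratedDeriv_exp_const_mul]
  simp

theorem pow_mul_exp_neg_le {a τ z : ℝ} (ha : 0 < a) (hτ : 0 < τ) (hz : a ≤ z) (i : ℕ) :
    τ ^ i * Real.exp (-τ * z) ≤ i.factorial / a ^ i := by
  have h1 := Real.pow_div_factorial_le_exp (a * τ) (by positivity) i
  have h2 : Real.exp (-τ * z) ≤ (Real.exp (a * τ))⁻¹ := by
    rw [← Real.exp_neg]
    refine Real.exp_le_exp.2 ?_
    nlinarith
  rw [div_le_iff₀ (by positivity), mul_pow] at h1
  rw [le_div_iff₀ (by positivity)]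
  have h3 := Real.exp_pos (a * τ)
  calc τ ^ i * Real.exp (-τ * z) * a ^ i ≤ τ ^ i * (Real.exp (a * τ))⁻¹ * a ^ i := by gcongr
    _ = (a ^ i * τ ^ i) * (Real.exp (a * τ))⁻¹ := by ring
    _ ≤ (Real.exp (a * τ) * i.factorial) * (Real.exp (a * τ))⁻¹ := by gcongr
    _ = i.factorial := by field_simp

theorem rpow_norm_dilate {n : ℕ} (α : ℝ) (j : ℤ) (ξ : Eu n) :
    ‖(2 * Real.pi) • (((2 : ℝ) ^ j)⁻¹ • ξ)‖ ^ (2 * α)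
      = (((2 : ℝ) ^ (2 * α)) ^ j)⁻¹ * ‖(2 * Real.pi) • ξ‖ ^ (2 * α) := by
  have h : (((2 : ℝ) ^ j) ^ (2 * α)) = ((2 : ℝ) ^ (2 * α)) ^ j := by
    rw [← Real.rpow_intCast, ← Real.rpow_intCast, ← Real.rpow_mul (by norm_num),
      ← Real.rpow_mul (by norm_num), mul_comm]
  rw [smul_comm, norm_smul, Real.norm_of_nonneg (by positivity),
    Real.mul_rpow (by positivity) (norm_nonneg _), Real.inv_rpow (by positivity), h]

theorem exists_dilate_exp_kernel {n : ℕ} (α : ℝ) {χ : 𝓢(Eu n, ℂ)} {τ : ℝ} (j : ℤ) {k : 𝓢(Eu n, ℂ)}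
    (hk : ∀ ξ, (𝓕 k : 𝓢(Eu n, ℂ)) ξ
      = χ ξ * (Real.exp (τ * ((2 : ℝ) ^ (2 * α)) ^ j * ‖(2 * Real.pi) • ξ‖ ^ (2 * α)) : ℝ)) :
    ∃ k' : 𝓢(Eu n, ℂ), (∀ ξ, (𝓕 k' : 𝓢(Eu n, ℂ)) ξ = χ (((2 : ℝ) ^ j)⁻¹ • ξ)
        * (Real.exp (τ * ‖(2 * Real.pi) • ξ‖ ^ (2 * α)) : ℝ)) ∧
      eLpNorm k' 1 volume = eLpNorm k 1 volume := by
  obtain ⟨k', h1, h2⟩ := exists_dilate_kernel k (c := (2 : ℝ) ^ j) (by positivity)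
  refine ⟨k', fun ξ => ?_, h2⟩
  have : ((2 : ℝ) ^ (2 * α)) ^ j ≠ 0 := by positivity
  rw [h1, hk, rpow_norm_dilate, mul_assoc, mul_inv_cancel_left₀ this]

/-- On the unit annulus `|2πξ|^{2α} ≥ a > 0`, so each factor `τ` produced by differentiating `exp
(-τ z)` is absorbed by the exponential, and so are `M` further factors; this gives the decay
`τ^{-M}`. -/
theorem exists_heat_kernel {n : ℕ} (α : ℝ) (χ : 𝓢(Eu n, ℂ)) {r R : ℝ} (hr : 0 < r)
    (hχ : ∀ x, χ x ≠ 0 → r ≤ ‖x‖ ∧ ‖x‖ ≤ R) (hα : 0 < α) (M : ℕ) :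
    ∃ C : ℝ≥0, ∀ (j : ℤ) (t : ℝ), 0 < t → ∃ k : 𝓢(Eu n, ℂ),
      (∀ ξ, (𝓕 k : 𝓢(Eu n, ℂ)) ξ = χ (((2 : ℝ) ^ j)⁻¹ • ξ)
        * (Real.exp (-t * ‖(2 * Real.pi) • ξ‖ ^ (2 * α)) : ℝ)) ∧
      eLpNorm k 1 volume ≤ C * ENNReal.ofReal (min 1 ((t * ((2 : ℝ) ^ (2 * α)) ^ j) ^ M)⁻¹) := by
  obtain ⟨C, N, h⟩ := exists_kernel (moderate_rpow_norm n α) χ hr hχ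
  set a : ℝ := (2 * Real.pi * r) ^ (2 * α)
  have ha : 0 < a := by positivity
  -- The range reaches `N + M`: up to `N` powers of `τ` come from derivatives and `M` more from the
  -- factor `τ ^ M` moved to the left.
  set D : ℝ := ∑ i ∈ Finset.range (N + M + 1), i.factorial / a ^ i
  have hD : ∀ i ≤ N + M, i.factorial / a ^ i ≤ D := fun i hi =>
    Finset.single_le_sum (f := fun i : ℕ => (i.factorial : ℝ) / a ^ i)
      (fun _ _ => by positivity) (Finset.mem_range.2 (by omega))
  have hD0 : 0 ≤ D := Finset.sum_nonneg fun _ _ => by positivity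
  refine ⟨C * D.toNNReal, fun j t ht => ?_⟩
  set τ : ℝ := t * ((2 : ℝ) ^ (2 * α)) ^ j
  have hτ : 0 < τ := by positivity
  have hm : 0 ≤ min 1 (τ ^ M)⁻¹ := by positivity
  obtain ⟨k, hk1, hk2⟩ := h (fun z => ((Real.exp (-τ * z) : ℝ) : ℂ))
    (contDiff_exp_mul _) (D * min 1 (τ ^ M)⁻¹).toNNReal (by
      intro i hi x hx _
      rw [Real.coe_toNNReal _ (by positivity), norm_iteratedFDeriv_exp_mul, abs_neg,
        abs_of_pos hτ]
      have hz : a ≤ ‖(2 * Real.pi) • x‖ ^ (2 * α) := by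
        rw [norm_smul, Real.norm_of_nonneg (by positivity)]
        exact Real.rpow_le_rpow (by positivity) (by gcongr) (by positivity)
      rw [mul_min_of_nonneg _ _ hD0, mul_one]
      refine le_min ((pow_mul_exp_neg_le ha hτ hz i).trans (hD i (by omega))) ?_
      rw [← div_eq_mul_inv, le_div_iff₀ (by positivity)]
      calc _ = τ ^ (i + M) * Real.exp (-τ * ‖(2 * Real.pi) • x‖ ^ (2 * α)) := by ring
        _ ≤ D := (pow_mul_exp_neg_le ha hτ hz (i + M)).trans (hD _ (by omega)))
  obtain ⟨k', hk'1, hk'2⟩ := exists_dilate_exp_kernel α (χ := χ) (τ := -t) j (k := k) (by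
    intro ξ
    rw [hk1, neg_mul t])
  refine ⟨k', hk'1, hk'2.trans_le (hk2.trans (le_of_eq ?_))⟩
  rw [ENNReal.coe_mul, mul_assoc]
  congr 1
  rw [← ENNReal.ofReal, ← ENNReal.ofReal, ENNReal.ofReal_mul hD0]

/-- The growing exponential is harmless because `τ ≤ T` and `|2πξ|^{2α}` is bounded on the annulus.
-/
theorem exists_inverse_heat_kernel {n : ℕ} (α : ℝ) (χ : 𝓢(Eu n, ℂ)) {r R : ℝ} (hr : 0 < r)
    (hχ : ∀ x, χ x ≠ 0 → r ≤ ‖x‖ ∧ ‖x‖ ≤ R) (hα : 0 < α) (T : ℝ) :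
    ∃ C : ℝ≥0, ∀ (j : ℤ) (t : ℝ), 0 < t → t * ((2 : ℝ) ^ (2 * α)) ^ j ≤ T →
      ∃ k : 𝓢(Eu n, ℂ),
      (∀ ξ, (𝓕 k : 𝓢(Eu n, ℂ)) ξ = χ (((2 : ℝ) ^ j)⁻¹ • ξ)
        * (Real.exp (t * ‖(2 * Real.pi) • ξ‖ ^ (2 * α)) : ℝ)) ∧
      eLpNorm k 1 volume ≤ C := by
  obtain ⟨C, N, h⟩ := exists_kernel (moderate_rpow_norm n α) χ hr hχ
  set b : ℝ := (2 * Real.pi * |R|) ^ (2 * α)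
  have hb : 0 ≤ b := by positivity
  set D : ℝ := max 1 T ^ N * Real.exp (T * b)
  have hD0 : 0 ≤ D := by positivity
  refine ⟨C * D.toNNReal, fun j t ht hT => ?_⟩
  set τ : ℝ := t * ((2 : ℝ) ^ (2 * α)) ^ j
  have hτ : 0 < τ := by positivity
  obtain ⟨k, hk1, hk2⟩ := h (fun z => ((Real.exp (τ * z) : ℝ) : ℂ))
    (contDiff_exp_mul _) D.toNNReal (by
      intro i hi x _ hx
      rw [Real.coe_toNNReal _ hD0, norm_iteratedFDeriv_exp_mul, abs_of_pos hτ]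
      have hz : ‖(2 * Real.pi) • x‖ ^ (2 * α) ≤ b := by
        rw [norm_smul, Real.norm_of_nonneg (by positivity)]
        exact Real.rpow_le_rpow (by positivity)
          (by have := hx.trans (le_abs_self R); gcongr) (by positivity)
      have h1 : τ ^ i ≤ max 1 T ^ N :=
        (pow_le_pow_left₀ hτ.le (hT.trans (le_max_right _ _)) i).trans
          (pow_le_pow_right₀ (le_max_left _ _) hi)
      have h2 : τ * ‖(2 * Real.pi) • x‖ ^ (2 * α) ≤ T * b :=
        mul_le_mul hT hz (by positivity) (hτ.le.trans hT)
      exact mul_le_mul h1 (Real.exp_le_exp.2 h2) (by positivity) (by positivity))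
  obtain ⟨k', hk'1, hk'2⟩ := exists_dilate_exp_kernel α (χ := χ) (τ := t) j (k := k) hk1
  refine ⟨k', hk'1, hk'2.trans_le (hk2.trans (le_of_eq ?_))⟩
  rw [ENNReal.coe_mul]

/-! ### Pairing a functional on `𝒵` with an integral of translates -/

section Translates

variable {n : ℕ}

/-- The Schwartz function `y ↦ η (y - x)`. -/
noncomputable abbrev shift (η : 𝓢(Eu n, ℂ)) (x : Eu n) : 𝓢(Eu n, ℂ) :=
  SchwartzMap.compSubConstCLM ℂ x η

/-- The Schwartz function `y ↦ θ (-y)`. -/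
noncomputable def reflect (θ : 𝓢(Eu n, ℂ)) : 𝓢(Eu n, ℂ) :=
  SchwartzMap.compCLMOfContinuousLinearEquiv ℂ (ContinuousLinearEquiv.neg ℝ) θ

theorem reflect_apply (θ : 𝓢(Eu n, ℂ)) (x : Eu n) : reflect θ x = θ (-x) := rfl

theorem shift_reflect_apply (θ : 𝓢(Eu n, ℂ)) (x y : Eu n) :
    shift (reflect θ) x y = θ (x - y) := by
  rw [SchwartzMap.compSubConstCLM_apply, reflect_apply, neg_sub]

theorem iteratedFDeriv_shift (η : 𝓢(Eu n, ℂ)) (l : ℕ) (x z : Eu n) :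
    iteratedFDeriv ℝ l (shift η x) z = iteratedFDeriv ℝ l η (z - x) :=
  iteratedFDeriv_comp_sub l x z

/-- Uses `|z| ≤ (1 + |x|)(1 + |z - x|)`. Seminorms of a translate grow only polynomially in `x`, so
they are integrable against a Schwartz function. -/
theorem norm_pow_mul_iteratedFDeriv_shift_le (η : 𝓢(Eu n, ℂ)) (k l : ℕ) :
    ∃ C : ℝ, 0 ≤ C ∧ ∀ x z,
      ‖z‖ ^ k * ‖iteratedFDeriv ℝ l (shift η x) z‖ ≤ C * (1 + ‖x‖) ^ k := by
  refine ⟨2 ^ k * (Finset.Iic (k, l)).sup (fun m => SchwartzMap.seminorm ℝ m.1 m.2) η,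
    by positivity, fun x z => ?_⟩
  have h := SchwartzMap.one_add_le_sup_seminorm_apply (𝕜 := ℝ) (m := (k, l)) le_rfl le_rfl η (z - x)
  rw [iteratedFDeriv_shift]
  have h1 : ‖z‖ ≤ (1 + ‖x‖) * (1 + ‖z - x‖) := by
    have : ‖z‖ ≤ ‖x‖ + ‖z - x‖ := by
      have := norm_add_le x (z - x); rwa [add_sub_cancel] at this
    nlinarith [norm_nonneg x, norm_nonneg (z - x), mul_nonneg (norm_nonneg x) (norm_nonneg (z - x))]
  calc _ ≤ ((1 + ‖x‖) * (1 + ‖z - x‖)) ^ k * ‖iteratedFDeriv ℝ l η (z - x)‖ := by gcongr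
    _ = (1 + ‖x‖) ^ k * ((1 + ‖z - x‖) ^ k * ‖iteratedFDeriv ℝ l η (z - x)‖) := by
        rw [mul_pow]; ring
    _ ≤ (1 + ‖x‖) ^ k * _ := by gcongr
    _ = _ := mul_comm _ _

theorem norm_pow_mul_iteratedFDeriv_shift_sub_le (η : 𝓢(Eu n, ℂ)) (k l : ℕ) (x₀ : Eu n) :
    ∃ C : ℝ, 0 ≤ C ∧ ∀ x, ‖x - x₀‖ ≤ 1 → ∀ z,
      ‖z‖ ^ k * ‖iteratedFDeriv ℝ l η (z - x) - iteratedFDeriv ℝ l η (z - x₀)‖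
        ≤ C * ‖x - x₀‖ := by
  set A : ℝ := 2 ^ k * (Finset.Iic (k, l + 1)).sup (fun m => SchwartzMap.seminorm ℝ m.1 m.2) η
  refine ⟨(2 + ‖x₀‖) ^ k * A, by positivity, fun x hx z => ?_⟩
  have hd : Differentiable ℝ (iteratedFDeriv ℝ l η) :=
    (η.smooth ⊤).differentiable_iteratedFDeriv (by exact_mod_cast ENat.natCast_lt_top l)
  -- The weight `‖z‖ ^ k` is frozen at the given `z`, so the mean value inequality on the ball
  -- around `z - x₀` differentiates only `η`.
  set f : Eu n → _ := fun w => (‖z‖ ^ k) • iteratedFDeriv ℝ l η w with hf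
  have h := (convex_closedBall (z - x₀) ‖x - x₀‖).norm_image_sub_le_of_norm_fderiv_le (𝕜 := ℝ)
    (f := f) (C := (2 + ‖x₀‖) ^ k * A) (x := z - x₀) (y := z - x) ?_ ?_ (by simp)
    (by rw [mem_closedBall_iff_norm, sub_sub_sub_cancel_left, norm_sub_rev])
  · rw [hf] at h
    simp only at h
    rw [← smul_sub, norm_smul, norm_pow, norm_norm, sub_sub_sub_cancel_left, norm_sub_rev x₀] at h
    exact h
  · intro w _
    exact (hd w).const_smul (‖z‖ ^ k : ℝ)
  · intro w hw
    rw [mem_closedBall_iff_norm] at hw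
    rw [hf, fderiv_fun_const_smul (hd w), norm_smul, norm_fderiv_iteratedFDeriv, norm_pow, norm_norm]
    have h0 := SchwartzMap.one_add_le_sup_seminorm_apply (𝕜 := ℝ) (m := (k, l + 1)) le_rfl le_rfl η w
    have h1 : ‖z‖ ≤ (2 + ‖x₀‖) * (1 + ‖w‖) := by
      have h2 : ‖z‖ ≤ ‖x₀‖ + ‖z - x₀‖ := by
        have := norm_add_le x₀ (z - x₀); rwa [add_sub_cancel] at this
      have h3 : ‖z - x₀‖ ≤ ‖w‖ + 1 := by
        have h4 := norm_sub_norm_le (z - x₀) w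
        rw [norm_sub_rev] at hw
        linarith
      nlinarith [norm_nonneg x₀, norm_nonneg w, mul_nonneg (norm_nonneg x₀) (norm_nonneg w)]
    calc _ ≤ ((2 + ‖x₀‖) * (1 + ‖w‖)) ^ k * ‖iteratedFDeriv ℝ (l + 1) η w‖ := by gcongr
      _ = (2 + ‖x₀‖) ^ k * ((1 + ‖w‖) ^ k * ‖iteratedFDeriv ℝ (l + 1) η w‖) := by
          rw [mul_pow]; ring
      _ ≤ _ := by gcongr

theorem continuous_shift (η : 𝓢(Eu n, ℂ)) : Continuous (shift η) := by
  rw [continuous_iff_continuousAt]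
  intro x₀
  rw [ContinuousAt, (schwartz_withSeminorms ℂ (Eu n) ℂ).tendsto_nhds]
  intro i ε hε
  obtain ⟨C, hC0, hC⟩ := norm_pow_mul_iteratedFDeriv_shift_sub_le η i.1 i.2 x₀
  have hlim : Tendsto (fun x => C * ‖x - x₀‖) (𝓝 x₀) (𝓝 0) := by
    have : Continuous fun x => C * ‖x - x₀‖ := by fun_prop
    simpa using this.tendsto x₀
  filter_upwards [hlim.eventually (gt_mem_nhds hε), Metric.closedBall_mem_nhds x₀ one_pos]
    with x hx hx1
  rw [mem_closedBall_iff_norm] at hx1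
  refine lt_of_le_of_lt ?_ hx
  refine SchwartzMap.seminorm_le_bound ℂ _ _ _ (by positivity) fun z => ?_
  have e : ((shift η x - shift η x₀ : 𝓢(Eu n, ℂ)) : Eu n → ℂ)
      = (shift η x : Eu n → ℂ) - (shift η x₀ : Eu n → ℂ) := rfl
  rw [e, iteratedFDeriv_sub_apply ((SchwartzMap.contDiffAt _ ⊤).of_le (by exact_mod_cast le_top))
    ((SchwartzMap.contDiffAt _ ⊤).of_le (by exact_mod_cast le_top)), iteratedFDeriv_shift,
    iteratedFDeriv_shift]
  exact hC x hx1 z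

theorem continuous_iteratedFDeriv (η : 𝓢(Eu n, ℂ)) (l : ℕ) : Continuous (iteratedFDeriv ℝ l η) :=
  (η.smooth ⊤).continuous_iteratedFDeriv (mod_cast le_top)

theorem integrable_smul_iteratedFDeriv (η h : 𝓢(Eu n, ℂ)) (l : ℕ) (z : Eu n) :
    Integrable fun y => h y • iteratedFDeriv ℝ l η (z - y) := by
  refine Integrable.mono' (h.integrable.norm.mul_const (SchwartzMap.seminorm ℝ 0 l η)) ?_ ?_
  · exact (h.continuous.smul ((continuous_iteratedFDeriv η l).comp (by fun_prop))).aestronglyMeasurable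
  · refine Eventually.of_forall fun y => ?_
    rw [norm_smul]
    gcongr
    exact η.norm_iteratedFDeriv_le_seminorm ℝ l _

theorem hasFDerivAt_integral_smul_sub {V : Type*} [NormedAddCommGroup V] [NormedSpace ℝ V]
    [NormedSpace ℂ V] [SMulCommClass ℝ ℂ V] (h : 𝓢(Eu n, ℂ)) {φ : Eu n → V}
    (hd : Differentiable ℝ φ) (hc : Continuous (fderiv ℝ φ)) {C₀ C₁ : ℝ}
    (h₀ : ∀ x, ‖φ x‖ ≤ C₀) (h₁ : ∀ x, ‖fderiv ℝ φ x‖ ≤ C₁) (z : Eu n) :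
    HasFDerivAt (fun z => ∫ y, h y • φ (z - y)) (∫ y, h y • fderiv ℝ φ (z - y)) z := by
  have hm : ∀ z, AEStronglyMeasurable (fun y => h y • φ (z - y)) volume := fun z =>
    (h.continuous.smul (hd.continuous.comp (by fun_prop))).aestronglyMeasurable
  refine hasFDerivAt_integral_of_dominated_of_fderiv_le (𝕜 := ℝ) (s := univ)
    (bound := fun y => ‖h y‖ * C₁)
    (F' := fun z y => h y • fderiv ℝ φ (z - y)) univ_mem
    (Eventually.of_forall hm) ?_ ?_ ?_ (h.integrable.norm.mul_const _) ?_
  · refine Integrable.mono' (h.integrable.norm.mul_const C₀) (hm z) (Eventually.of_forall fun y => ?_)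
    rw [norm_smul]
    gcongr
    exact h₀ _
  · exact (h.continuous.smul (hc.comp (by fun_prop))).aestronglyMeasurable
  · refine Eventually.of_forall fun y x _ => ?_
    rw [norm_smul]
    gcongr
    exact h₁ _
  · refine Eventually.of_forall fun y x _ => ?_
    have h1 := (hd (x - y)).hasFDerivAt.comp x ((hasFDerivAt_id x).sub_const y)
    exact h1.const_smul (h y)

theorem LinearIsometryEquiv.integral_comp_eq {β V W : Type*} [MeasurableSpace β] {μ : Measure β}
    [NormedAddCommGroup V] [NormedSpace ℝ V] [NormedAddCommGroup W] [NormedSpace ℝ W]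
    (e : V ≃ₗᵢ[ℝ] W) (φ : β → V) : ∫ y, e (φ y) ∂μ = e (∫ y, φ y ∂μ) :=
  e.toContinuousLinearEquiv.integral_comp_comm φ

/-- Differentiation under the integral, one order at a time. Each step is transported through the
currying isometry, which commutes with Bochner integrals. -/
theorem iteratedFDeriv_integral_shift (η h : 𝓢(Eu n, ℂ)) (l : ℕ) (z : Eu n) :
    iteratedFDeriv ℝ l (fun z => ∫ y, h y • η (z - y)) z
      = ∫ y, h y • iteratedFDeriv ℝ l η (z - y) := by
  induction l generalizing z with
  | zero =>
    ext m
    rw [iteratedFDeriv_zero_apply]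
    have := integrable_smul_iteratedFDeriv η h 0 z
    rw [ContinuousMultilinearMap.integral_apply this]
    rfl
  | succ l ih =>
    have hd : Differentiable ℝ (iteratedFDeriv ℝ l η) :=
      (η.smooth ⊤).differentiable_iteratedFDeriv (by exact_mod_cast ENat.natCast_lt_top l)
    have hfd := hasFDerivAt_integral_smul_sub h hd
      ((continuousMultilinearCurryLeftEquiv ℝ (fun _ : Fin (l + 1) => Eu n) ℂ).symm.comp_continuous_iff.1
        (by rw [← iteratedFDeriv_succ_eq_comp_left]; exact continuous_iteratedFDeriv η (l + 1)))
      (η.norm_iteratedFDeriv_le_seminorm ℝ l) (fun x => by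
        rw [norm_fderiv_iteratedFDeriv]
        exact η.norm_iteratedFDeriv_le_seminorm ℝ (l + 1) x) z
    have e : iteratedFDeriv ℝ l (fun z => ∫ y, h y • η (z - y))
        = fun z => ∫ y, h y • iteratedFDeriv ℝ l η (z - y) := funext ih
    rw [iteratedFDeriv_succ_eq_comp_left, Function.comp_apply, e, hfd.fderiv]
    refine (LinearIsometryEquiv.integral_comp_eq (β := Eu n) (μ := volume) (V := Eu n →L[ℝ] Eu n [×l]→L[ℝ] ℂ)
      (W := Eu n [×(l + 1)]→L[ℝ] ℂ)
      (continuousMultilinearCurryLeftEquiv ℝ (fun _ : Fin (l + 1) => Eu n) ℂ).symm _).symm.trans ?_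
    refine integral_congr_ae (Eventually.of_forall fun y => ?_)
    simp only [iteratedFDeriv_succ_eq_comp_left]
    rfl

end Translates

/-- Bounded continuous functions on `ℝⁿ` with values in a normed space. -/
abbrev Bdd (n : ℕ) (V : Type*) [NormedAddCommGroup V] := Eu n →ᵇ V

/-- A weak integral computed in a Banach space: the maps `A i` embed `X` in a finite product of
spaces of bounded functions, and `hf` says that `f` is continuous for the induced norm. There `∫
h(y) J(T y) dy` exists as a Bochner integral, equals `J G` by evaluation at points, and commutes
with an extension of `f`. -/
theorem integral_functional_eq {n : ℕ} {X ι : Type*} [AddCommGroup X] [Module ℂ X] [Fintype ι]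
    {V : ι → Type*} [∀ i, NormedAddCommGroup (V i)] [∀ i, NormedSpace ℂ (V i)]
    [∀ i, CompleteSpace (V i)] (f : X →ₗ[ℂ] ℂ) (A : ∀ i, X →ₗ[ℂ] Bdd n (V i)) (C : ℝ)
    (hf : ∀ g b, (∀ i, ‖A i g‖ ≤ b) → ‖f g‖ ≤ C * b) (hA : ∀ g, (∀ i, A i g = 0) → g = 0)
    {T : Eu n → X} (hT : ∀ i, Continuous fun y => A i (T y)) {h : Eu n → ℂ} (hh : Continuous h)
    (hint : ∀ i, Integrable fun y => ‖h y‖ * ‖A i (T y)‖) (G : X)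
    (hG : ∀ i x, ∫ y, h y • A i (T y) x = A i G x) :
    ∫ y, h y * f (T y) = f G := by
  set J : X →ₗ[ℂ] ((i : ι) → Bdd n (V i)) := LinearMap.pi A with hJ
  have hJi : ∀ g i, J g i = A i g := fun g i => rfl
  have hinj : Function.Injective J := by
    rw [injective_iff_map_eq_zero]
    intro g hg
    exact hA g fun i => by rw [← hJi, hg]; rfl
  set e := LinearEquiv.ofInjective J hinj
  set F₀ : LinearMap.range J →L[ℂ] ℂ :=
    (f ∘ₗ e.symm.toLinearMap).mkContinuous C (by
      intro r
      obtain ⟨g, rfl⟩ := e.surjective r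
      rw [LinearMap.comp_apply, LinearEquiv.coe_coe, LinearEquiv.symm_apply_apply]
      exact hf g _ fun i => norm_le_pi_norm (J g) i)
  -- Hahn–Banach: the Bochner integral is formed in the whole product, so the functional must be
  -- defined beyond the range of `J`.
  obtain ⟨F, hF, -⟩ := exists_extension_norm_eq _ F₀
  have hFJ : ∀ g, f g = F (J g) := fun g => by
    have h1 := hF (e g)
    have h2 : ((e g : LinearMap.range J) : (i : ι) → Bdd n (V i)) = J g := rfl
    rw [h2] at h1
    rw [h1]
    simp [F₀]
  have hJT : Continuous fun y => J (T y) := continuous_pi hT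
  have hI : Integrable fun y => h y • J (T y) := by
    refine Integrable.mono' (integrable_finsetSum Finset.univ fun i _ => hint i)
      (hh.smul hJT).aestronglyMeasurable (Eventually.of_forall fun y => ?_)
    have hnn : ∀ i ∈ Finset.univ, 0 ≤ ‖h y‖ * ‖A i (T y)‖ := fun i _ => by positivity
    refine (pi_norm_le_iff_of_nonneg (Finset.sum_nonneg hnn)).2 fun i => ?_
    refine le_trans (le_of_eq ?_) (Finset.single_le_sum hnn (Finset.mem_univ i))
    exact (norm_smul (h y) (A i (T y)))
  have key : ∫ y, h y • J (T y) = J G := by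
    funext i
    ext1 x
    set L : ((i : ι) → Bdd n (V i)) →L[ℂ] V i :=
      (BoundedContinuousFunction.evalCLM ℂ x).comp (ContinuousLinearMap.proj i)
    have h1 := L.integral_comp_comm hI
    change L (∫ y, h y • J (T y)) = A i G x
    rw [← h1, ← hG]
    rfl
  rw [hFJ G, ← key, ← F.integral_comp_comm hI]
  refine integral_congr_ae (Eventually.of_forall fun y => ?_)
  simp only [map_smul, hFJ, smul_eq_mul]

/-! ### Weighted derivatives and the pairing formula -/

section Jet

variable {n : ℕ}

/-- The weighted derivative `x ↦ |x| ^ k D ^ l g (x)` as a bounded function. -/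
noncomputable def weightedDeriv (n k l : ℕ) :
    𝓢(Eu n, ℂ) →L[ℂ] Bdd n (Eu n [×l]→L[ℝ] ℂ) :=
  SchwartzMap.mkCLMtoNormedSpace
    (fun g => BoundedContinuousFunction.ofNormedAddCommGroup
      (fun x => (‖x‖ ^ k : ℝ) • iteratedFDeriv ℝ l g x)
      ((continuous_norm.pow k).smul (continuous_iteratedFDeriv g l))
      (SchwartzMap.seminorm ℂ k l g) fun x => by
        rw [norm_smul, norm_pow, norm_norm]
        exact SchwartzMap.le_seminorm ℂ k l g x)
    (fun f g => by
      ext1 x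
      have h : iteratedFDeriv ℝ l (⇑(f + g)) x = iteratedFDeriv ℝ l f x + iteratedFDeriv ℝ l g x :=
        iteratedFDeriv_add_apply ((SchwartzMap.contDiffAt _ ⊤).of_le (by exact_mod_cast le_top))
          ((SchwartzMap.contDiffAt _ ⊤).of_le (by exact_mod_cast le_top))
      simp only [BoundedContinuousFunction.coe_ofNormedAddCommGroup,
        BoundedContinuousFunction.coe_add, Pi.add_apply]
      rw [h, smul_add])
    (fun a f => by
      ext1 x
      have h : iteratedFDeriv ℝ l (⇑(a • f)) x = a • iteratedFDeriv ℝ l f x :=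
        iteratedFDeriv_const_smul_apply
          ((SchwartzMap.contDiffAt _ ⊤).of_le (by exact_mod_cast le_top))
      simp only [BoundedContinuousFunction.coe_ofNormedAddCommGroup, RingHom.id_apply,
        BoundedContinuousFunction.coe_smul]
      rw [h, smul_comm])
    ⟨{(k, l)}, 1, zero_le_one, fun f => by
      rw [one_mul, Finset.sup_singleton]
      exact BoundedContinuousFunction.norm_ofNormedAddCommGroup_le _ (by positivity) _⟩

theorem weightedDeriv_apply (k l : ℕ) (g : 𝓢(Eu n, ℂ)) (x : Eu n) :
    weightedDeriv n k l g x = (‖x‖ ^ k : ℝ) • iteratedFDeriv ℝ l g x := rfl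

theorem seminorm_le_norm_weightedDeriv (k l : ℕ) (g : 𝓢(Eu n, ℂ)) :
    SchwartzMap.seminorm ℂ k l g ≤ ‖weightedDeriv n k l g‖ := by
  refine SchwartzMap.seminorm_le_bound ℂ _ _ _ (norm_nonneg _) fun x => ?_
  have := (weightedDeriv n k l g).norm_coe_le_norm x
  rwa [weightedDeriv_apply, norm_smul, norm_pow, norm_norm] at this

theorem exists_bound_weightedDeriv (f : ZDual n) :
    ∃ (s : Finset (ℕ × ℕ)) (C : ℝ), (0, 0) ∈ s ∧ ∀ (g : Z n) (b : ℝ),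
      (∀ i : s, ‖weightedDeriv n i.1.1 i.1.2 g‖ ≤ b) → ‖f g‖ ≤ C * b := by
  have hw : WithSeminorms ((schwartzSeminormFamily ℂ (Eu n) ℂ).comp (Z n).subtype) :=
    Topology.IsInducing.withSeminorms (f := (Z n).subtype)
      (schwartz_withSeminorms ℂ (Eu n) ℂ) Topology.IsInducing.subtypeVal
  obtain ⟨s, C, -, hC⟩ := Seminorm.bound_of_continuous hw
    ((normSeminorm ℂ ℂ).comp f.toLinearMap) (continuous_norm.comp f.continuous)
  -- The index `(0, 0)` is added so that the family of weighted derivatives includes the function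
  -- itself and is therefore injective; it also forces `b ≥ 0`.
  refine ⟨insert (0, 0) s, C, Finset.mem_insert_self _ _, fun g b hb => (hC g).trans ?_⟩
  rw [smul_apply]
  change (C : ℝ) * _ ≤ C * b
  gcongr
  refine Seminorm.finset_sup_apply_le ?_ fun i hi => ?_
  · exact le_trans (norm_nonneg (weightedDeriv n 0 0 g)) (hb ⟨(0, 0), Finset.mem_insert_self _ _⟩)
  · exact (seminorm_le_norm_weightedDeriv i.1 i.2 _).trans
      (hb ⟨i, Finset.mem_insert_of_mem hi⟩)

theorem continuous_functional_shift (f : ZDual n) {η : 𝓢(Eu n, ℂ)} (hη : ∀ x, shift η x ∈ Z n) :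
    Continuous fun x => f ⟨shift η x, hη x⟩ :=
  f.continuous.comp ((continuous_shift η).subtype_mk hη)

theorem integrable_mul_weightedDeriv_shift (k l : ℕ) (η h : 𝓢(Eu n, ℂ)) :
    Integrable fun y => ‖h y‖ * ‖weightedDeriv n k l (shift η y)‖ := by
  obtain ⟨C, hC0, hC⟩ := norm_pow_mul_iteratedFDeriv_shift_le η k l
  refine Integrable.mono' (((h.integrable (μ := volume)).norm.add
    (SchwartzMap.integrable_pow_mul volume h k)).const_mul (2 ^ k * C)) ?_ ?_
  · exact (h.continuous.norm.mul
      ((weightedDeriv n k l).continuous.comp (continuous_shift η)).norm).aestronglyMeasurable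
  · refine Eventually.of_forall fun y => ?_
    have h1 : ‖weightedDeriv n k l (shift η y)‖ ≤ C * (1 + ‖y‖) ^ k := by
      refine (BoundedContinuousFunction.norm_le (by positivity)).2 fun z => ?_
      rw [weightedDeriv_apply, norm_smul, norm_pow, norm_norm]
      exact hC y z
    have h2 : (1 + ‖y‖) ^ k ≤ 2 ^ k * (1 + ‖y‖ ^ k) := by
      rcases le_total 1 ‖y‖ with hy | hy
      · calc (1 + ‖y‖) ^ k ≤ (2 * ‖y‖) ^ k := by gcongr; linarith
          _ = 2 ^ k * ‖y‖ ^ k := mul_pow _ _ _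
          _ ≤ _ := by gcongr; linarith
      · calc (1 + ‖y‖) ^ k ≤ 2 ^ k := by gcongr; linarith
          _ ≤ _ := le_mul_of_one_le_right (by positivity) (le_add_of_nonneg_right (by positivity))
    rw [Real.norm_of_nonneg (by positivity)]
    calc _ ≤ ‖h y‖ * (C * (2 ^ k * (1 + ‖y‖ ^ k))) := by
          gcongr
          exact h1.trans (by gcongr)
      _ = 2 ^ k * C * (‖h y‖ + ‖y‖ ^ k * ‖h y‖) := by ring

/-- Since `f` is dominated by finitely many weighted derivatives, `integral_functional_eq` applies
with these as the maps `A i`. Its pointwise hypothesis is differentiation under the convolution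
integral. -/
theorem integral_functional_shift (f : ZDual n) {η : 𝓢(Eu n, ℂ)} (hη : ∀ x, shift η x ∈ Z n)
    (h : 𝓢(Eu n, ℂ)) (G : Z n) (hG : ∀ z, (G : 𝓢(Eu n, ℂ)) z = ∫ y, h y • η (z - y)) :
    ∫ y, h y * f ⟨shift η y, hη y⟩ = f G := by
  obtain ⟨s, C, hs, hC⟩ := exists_bound_weightedDeriv f
  refine integral_functional_eq (ι := s) (V := fun i => Eu n [×i.1.2]→L[ℝ] ℂ) f.toLinearMap
    (fun i => (weightedDeriv n i.1.1 i.1.2).toLinearMap ∘ₗ (Z n).subtype) C hC ?_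
    (T := fun y => ⟨shift η y, hη y⟩)
    (fun i => (weightedDeriv n i.1.1 i.1.2).continuous.comp (continuous_shift η)) h.continuous
    (fun i => integrable_mul_weightedDeriv_shift i.1.1 i.1.2 η h) G ?_
  · intro g hg
    have h0 := (seminorm_le_norm_weightedDeriv 0 0 (g : 𝓢(Eu n, ℂ))).trans
      (norm_le_zero_iff.2 (hg ⟨(0, 0), hs⟩))
    apply Subtype.ext
    ext x
    have := (SchwartzMap.norm_le_seminorm ℂ (g : 𝓢(Eu n, ℂ)) x).trans h0
    simpa using this
  · intro i x
    have h2 : ((G : 𝓢(Eu n, ℂ)) : Eu n → ℂ) = fun z => ∫ y, h y • η (z - y) := funext hG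
    change _ = (‖x‖ ^ i.1.1 : ℝ) • iteratedFDeriv ℝ i.1.2 ((G : 𝓢(Eu n, ℂ)) : Eu n → ℂ) x
    rw [h2, iteratedFDeriv_integral_shift, ← integral_smul]
    refine integral_congr_ae (Eventually.of_forall fun y => ?_)
    change h y • ((‖x‖ ^ i.1.1 : ℝ) • iteratedFDeriv ℝ i.1.2 (shift η y) x) = _
    rw [iteratedFDeriv_shift, smul_comm]

end Jet

/-! ### The dyadic decomposition on `𝒵` -/

theorem fourier_multiplier {n : ℕ} (m : Eu n → ℂ) (hm : Moderate m) (g : Z n) (ξ : Eu n) :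
    (𝓕 ((multiplier m hm g : Z n) : 𝓢(Eu n, ℂ)) : 𝓢(Eu n, ℂ)) ξ
      = m ξ * (𝓕 (g : 𝓢(Eu n, ℂ)) : 𝓢(Eu n, ℂ)) ξ := by
  have h : ((multiplier m hm g : Z n) : 𝓢(Eu n, ℂ))
      = 𝓕⁻ (FlatAtZero.toSchwartz (fun ξ => m ξ * (𝓕 (g : 𝓢(Eu n, ℂ)) : 𝓢(Eu n, ℂ)) ξ)
        (FlatAtZero.moderate_mul hm (flat_of_iteratedFDeriv_eq_zero _ g.2))) := rfl
  rw [h, FourierTransform.fourier_fourierInv_eq]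
  rfl

theorem fourier_sub {n : ℕ} (f g : 𝓢(Eu n, ℂ)) :
    (𝓕 (f - g) : 𝓢(Eu n, ℂ)) = 𝓕 f - 𝓕 g :=
  map_sub (FourierTransform.fourierCLM ℂ 𝓢(Eu n, ℂ)) f g

theorem eq_of_fourier_eq {n : ℕ} {f g : 𝓢(Eu n, ℂ)}
    (h : ∀ ξ, (𝓕 f : 𝓢(Eu n, ℂ)) ξ = (𝓕 g : 𝓢(Eu n, ℂ)) ξ) : f = g := by
  have h1 : (𝓕 f : 𝓢(Eu n, ℂ)) = 𝓕 g := SchwartzMap.ext h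
  calc f = 𝓕⁻ (𝓕 f : 𝓢(Eu n, ℂ)) := (FourierTransform.fourierInv_fourier_eq f).symm
    _ = g := by rw [h1]; exact FourierTransform.fourierInv_fourier_eq g

theorem norm_iteratedFDeriv_sub_add_le {E F : Type*} [NormedAddCommGroup E] [NormedSpace ℝ E]
    [NormedAddCommGroup F] [NormedSpace ℝ F] {a b c : E → F} {i : ℕ} (ha : ContDiff ℝ i a)
    (hb : ContDiff ℝ i b) (hc : ContDiff ℝ i c) (x : E) :
    ‖iteratedFDeriv ℝ i (fun x => a x - b x + c x) x‖ ≤ ‖iteratedFDeriv ℝ i a x‖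
      + ‖iteratedFDeriv ℝ i b x‖ + ‖iteratedFDeriv ℝ i c x‖ := by
  have h1 : iteratedFDeriv ℝ i (fun x => a x - b x + c x) x
      = iteratedFDeriv ℝ i a x - iteratedFDeriv ℝ i b x + iteratedFDeriv ℝ i c x := by
    rw [← iteratedFDeriv_sub_apply ha.contDiffAt hb.contDiffAt]
    exact iteratedFDeriv_add_apply (f := a - b) (ha.sub hb).contDiffAt hc.contDiffAt
  rw [h1]
  exact (norm_add_le _ _).trans (add_le_add (norm_sub_le _ _) le_rfl)

namespace Cutoff

variable {n : ℕ} (ψ : Cutoff n)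

/-- `ψ̂` in Mathlib's frequency variable, as a Schwartz function. -/
noncomputable def symbol : 𝓢(Eu n, ℂ) :=
  HasCompactSupport.toSchwartzMap (f := fun ξ : Eu n => (ψ.toFun ((2 * Real.pi) • ξ) : ℂ))
    (HasCompactSupport.intro (isCompact_closedBall 0 (2 / (2 * Real.pi))) fun ξ hξ => by
      rw [ψ.eq_zero, Complex.ofReal_zero]
      rw [norm_smul, Real.norm_of_nonneg (by positivity)]
      rw [mem_closedBall_zero_iff, not_le, div_lt_iff₀ (by positivity)] at hξ
      linarith)
    (Complex.ofRealCLM.contDiff.comp (ψ.smooth.comp (contDiff_const_smul _)))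

theorem symbol_apply (ξ : Eu n) : ψ.symbol ξ = (ψ.toFun ((2 * Real.pi) • ξ) : ℂ) := rfl

/-- Scale invariance: `|c|^i |D^i ψ(cξ)| = |ξ|^{-i} · |cξ|^i |D^i ψ(cξ)|`, and the last factor is at
most a Schwartz seminorm whatever `c` is. This makes the bounds on the remainder uniform in `J`. -/
theorem norm_iteratedFDeriv_symbol_dilate_le (c : ℝ) (i : ℕ) {ξ : Eu n} (hξ : ξ ≠ 0) :
    ‖iteratedFDeriv ℝ i (fun ξ => ψ.symbol (c • ξ)) ξ‖
      ≤ SchwartzMap.seminorm ℝ i i ψ.symbol * weight ξ ^ i := by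
  have h0 : 0 < ‖ξ‖ := norm_pos_iff.2 hξ
  rw [iteratedFDeriv_comp_const_smul c (ψ.symbol.smooth i), norm_smul, norm_pow]
  have h := SchwartzMap.le_seminorm ℝ i i ψ.symbol (c • ξ)
  rw [norm_smul, mul_pow] at h
  have h1 : ‖ξ‖⁻¹ ^ i ≤ weight ξ ^ i := by
    unfold weight
    gcongr
    linarith
  calc ‖c‖ ^ i * ‖iteratedFDeriv ℝ i ψ.symbol (c • ξ)‖
      = (‖c‖ ^ i * ‖ξ‖ ^ i * ‖iteratedFDeriv ℝ i ψ.symbol (c • ξ)‖) * ‖ξ‖⁻¹ ^ i := by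
        rw [inv_pow]; field_simp
    _ ≤ SchwartzMap.seminorm ℝ i i ψ.symbol * weight ξ ^ i := by gcongr

/-- The symbol of `1 - ∑_{|j| ≤ J} Δ_j`. -/
noncomputable def remainder (J : ℕ) (ξ : Eu n) : ℂ :=
  1 - ψ.symbol (((2 : ℝ) ^ J)⁻¹ • ξ) + ψ.symbol ((2 : ℝ) ^ (J + 1) • ξ)

theorem norm_iteratedFDeriv_remainder_le (J i : ℕ) {ξ : Eu n} (hξ : ξ ≠ 0) :
    ‖iteratedFDeriv ℝ i (ψ.remainder J) ξ‖
      ≤ (1 + 2 * SchwartzMap.seminorm ℝ i i ψ.symbol) * weight ξ ^ i := by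
  have hc : ∀ c : ℝ, ContDiff ℝ i fun ξ : Eu n => ψ.symbol (c • ξ) := fun c =>
    (ψ.symbol.smooth i).comp (contDiff_const_smul c)
  have h1 : ‖iteratedFDeriv ℝ i (fun _ : Eu n => (1 : ℂ)) ξ‖ ≤ 1 := by
    rcases eq_or_ne i 0 with rfl | hi
    · simp
    · rw [iteratedFDeriv_const_of_ne hi]; simp
  have hw : 1 ≤ weight ξ ^ i := one_le_pow₀ (one_le_weight hξ)
  have h0 := norm_iteratedFDeriv_sub_add_le (contDiff_const (c := (1 : ℂ))) (hc ((2 : ℝ) ^ J)⁻¹)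
    (hc ((2 : ℝ) ^ (J + 1))) ξ
  refine h0.trans ?_
  have h2 := ψ.norm_iteratedFDeriv_symbol_dilate_le ((2 : ℝ) ^ J)⁻¹ i hξ
  have h3 := ψ.norm_iteratedFDeriv_symbol_dilate_le ((2 : ℝ) ^ (J + 1)) i hξ
  linarith

theorem contDiff_remainder (J : ℕ) : ContDiff ℝ ∞ (ψ.remainder J) :=
  (contDiff_const.sub ((ψ.symbol.smooth ⊤).comp (contDiff_const_smul _))).add
    ((ψ.symbol.smooth ⊤).comp (contDiff_const_smul _))

theorem moderate_remainder (J : ℕ) : Moderate (ψ.remainder J) :=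
  ⟨fun _ _ => (ψ.contDiff_remainder J).contDiffAt, fun k =>
    ⟨_, k, fun _ hx => ψ.norm_iteratedFDeriv_remainder_le J k hx⟩⟩

theorem remainder_eq_zero (J : ℕ) {ξ : Eu n} (h1 : ((2 : ℝ) ^ J)⁻¹ ≤ ‖(2 * Real.pi) • ξ‖)
    (h2 : ‖(2 * Real.pi) • ξ‖ ≤ (2 : ℝ) ^ J) : ψ.remainder J ξ = 0 := by
  have h3 : (0 : ℝ) < 2 ^ J := by positivity
  rw [remainder, symbol_apply, symbol_apply, ψ.eq_one, ψ.eq_zero]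
  · simp
  · rw [smul_comm, norm_smul, Real.norm_of_nonneg (by positivity), pow_succ]
    rw [inv_le_iff_one_le_mul₀ h3] at h1
    linarith
  · rw [smul_comm, norm_smul, Real.norm_of_nonneg (by positivity), inv_mul_le_iff₀ h3]
    linarith

theorem pow_le_weight (J : ℕ) {ξ : Eu n} (hξ : ξ ≠ 0)
    (h : ¬ (((2 : ℝ) ^ J)⁻¹ < ‖(2 * Real.pi) • ξ‖ ∧ ‖(2 * Real.pi) • ξ‖ < (2 : ℝ) ^ J)) :
    (2 : ℝ) ^ J ≤ 2 * Real.pi * weight ξ := by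
  have h0 : 0 < ‖ξ‖ := norm_pos_iff.2 hξ
  have h0' := inv_pos.2 h0
  have h3 : (0 : ℝ) < 2 ^ J := by positivity
  have hpi := Real.pi_gt_three
  rw [norm_smul, Real.norm_of_nonneg (by positivity), not_and_or, not_lt, not_lt] at h
  unfold weight
  rcases h with h | h
  · rw [le_inv_comm₀ (by positivity) h3] at h
    refine h.trans ?_
    rw [mul_inv]
    have : (2 * Real.pi)⁻¹ ≤ 1 := inv_le_one_of_one_le₀ (by linarith)
    nlinarith
  · nlinarith

/-- The remainder vanishes for `2^{-J} ≤ |2πξ| ≤ 2^J`. Outside this region the weight is at least a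
multiple of `2^J`, and the rapid decay of `h` has a power of the weight to spare. -/
theorem norm_remainder_mul_le {h : Eu n → ℂ} (hh : FlatAtZero h) (k l : ℕ) :
    ∃ C : ℝ, 0 ≤ C ∧ ∀ (J : ℕ) (ξ : Eu n),
      ‖ξ‖ ^ k * ‖iteratedFDeriv ℝ l (fun ξ => ψ.remainder J ξ * h ξ) ξ‖ ≤ C * ((2 : ℝ) ^ J)⁻¹ := by
  -- Of the `k + l + 1` powers, `k` absorb `‖ξ‖ ^ k`, at most `l` the derivatives of the remainder,
  -- and the last one becomes `2^{-J}`.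
  choose H hH using fun i => hh.2.2 i (k + l + 1)
  set S : ℕ → ℝ := fun i => 1 + 2 * SchwartzMap.seminorm ℝ i i ψ.symbol with hS
  have hS0 : ∀ i, 0 ≤ S i := fun i => by rw [hS]; positivity
  set D : ℝ := ∑ i ∈ Finset.range (l + 1), (l.choose i : ℝ) * S i * |H (l - i)| with hD
  have hD0 : 0 ≤ D := Finset.sum_nonneg fun i _ => by have := hS0 i; positivity
  refine ⟨D * (2 * Real.pi), by positivity, fun J ξ => ?_⟩
  by_cases hξ : ξ = 0
  · subst hξ
    rw [(FlatAtZero.contDiff_nat l (hh.moderate_mul (ψ.moderate_remainder J))).2, norm_zero,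
      norm_zero, mul_zero]
    positivity
  by_cases hr : ((2 : ℝ) ^ J)⁻¹ < ‖(2 * Real.pi) • ξ‖ ∧ ‖(2 * Real.pi) • ξ‖ < (2 : ℝ) ^ J
  · have ho : {ξ : Eu n | ((2 : ℝ) ^ J)⁻¹ < ‖(2 * Real.pi) • ξ‖ ∧ ‖(2 * Real.pi) • ξ‖ < (2 : ℝ) ^ J}
        ∈ 𝓝 ξ := by
      have hc : Continuous fun ξ : Eu n => ‖(2 * Real.pi) • ξ‖ := (continuous_const_smul _).norm
      exact ((isOpen_lt continuous_const hc).inter (isOpen_lt hc continuous_const)).mem_nhds hr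
    have he : (fun ξ => ψ.remainder J ξ * h ξ) =ᶠ[𝓝 ξ] fun _ => 0 := by
      filter_upwards [ho] with x hx
      rw [ψ.remainder_eq_zero J hx.1.le hx.2.le, zero_mul]
    rw [(he.iteratedFDeriv ℝ l).eq_of_nhds, iteratedFDeriv_fun_zero]
    simp only [Pi.zero_apply, norm_zero, mul_zero]
    positivity
  · have hw := pow_le_weight J hξ hr
    have hw1 := one_le_weight hξ
    have hw0 : 0 < weight ξ := by linarith
    have ho : IsOpen ({0}ᶜ : Set (Eu n)) := isOpen_compl_singleton
    have hxo : ξ ∈ ({0}ᶜ : Set (Eu n)) := hξ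
    have hm := norm_iteratedFDerivWithin_mul_le (𝕜 := ℝ) (A := ℂ) (f := ψ.remainder J)
      (g := h) (s := {0}ᶜ) (N := ∞) (n := l) (ψ.contDiff_remainder J).contDiffOn
      (fun y hy => (hh.2.1 y hy).contDiffWithinAt) ho.uniqueDiffOn
      (x := ξ) hxo (by exact_mod_cast le_top)
    simp only [iteratedFDerivWithin_of_isOpen _ ho hxo] at hm
    have hn : ‖ξ‖ ≤ weight ξ := by
      unfold weight
      have : 0 ≤ ‖ξ‖⁻¹ := by positivity
      linarith
    have h1 : weight ξ * (‖ξ‖ ^ k * ‖iteratedFDeriv ℝ l (fun ξ => ψ.remainder J ξ * h ξ) ξ‖) ≤ D := by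
      calc _ ≤ weight ξ * (weight ξ ^ k * ∑ i ∈ Finset.range (l + 1), (l.choose i : ℝ) *
            ‖iteratedFDeriv ℝ i (ψ.remainder J) ξ‖ * ‖iteratedFDeriv ℝ (l - i) h ξ‖) := by gcongr
        _ = ∑ i ∈ Finset.range (l + 1), (l.choose i : ℝ) * (weight ξ ^ (k + 1) *
            ‖iteratedFDeriv ℝ i (ψ.remainder J) ξ‖ * ‖iteratedFDeriv ℝ (l - i) h ξ‖) := by
          rw [Finset.mul_sum, Finset.mul_sum]
          exact Finset.sum_congr rfl fun i _ => by ring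
        _ ≤ D := by
          refine Finset.sum_le_sum fun i hi => ?_
          refine (mul_le_mul_of_nonneg_left ?_ (Nat.cast_nonneg (l.choose i))).trans_eq
            (mul_assoc _ (S i) |H (l - i)|).symm
          have hil : i ≤ l := by have := Finset.mem_range.1 hi; omega
          calc _ ≤ weight ξ ^ (k + 1) * (S i * weight ξ ^ l) * ‖iteratedFDeriv ℝ (l - i) h ξ‖ := by
                gcongr
                refine (ψ.norm_iteratedFDeriv_remainder_le J i hξ).trans ?_
                exact mul_le_mul_of_nonneg_left (pow_le_pow_right₀ hw1 hil) (hS0 i)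
            _ = S i * (weight ξ ^ (k + l + 1) * ‖iteratedFDeriv ℝ (l - i) h ξ‖) := by ring
            _ ≤ S i * |H (l - i)| := by
                have := hS0 i
                gcongr
                exact (hH (l - i) ξ hξ).trans (le_abs_self _)
    have h3 : (0 : ℝ) < 2 ^ J := by positivity
    rw [← div_eq_mul_inv, le_div_iff₀ h3]
    set X := ‖ξ‖ ^ k * ‖iteratedFDeriv ℝ l (fun ξ => ψ.remainder J ξ * h ξ) ξ‖
    have hX : 0 ≤ X := by positivity
    calc X * 2 ^ J ≤ X * (2 * Real.pi * weight ξ) := by gcongr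
      _ = (weight ξ * X) * (2 * Real.pi) := by ring
      _ ≤ D * (2 * Real.pi) := by gcongr

theorem sum_phiHatJ (J : ℕ) (ξ : Eu n) :
    ∑ j ∈ Finset.Icc (-(J : ℤ)) J, ψ.phiHatJ j ξ
      = ψ.toFun (((2 : ℝ) ^ J)⁻¹ • ξ) - ψ.toFun ((2 : ℝ) ^ (J + 1) • ξ) := by
  have e : ∀ j : ℤ, ψ.phiHatJ j ξ
      = ψ.toFun ((2 : ℝ) ^ (-j) • ξ) - ψ.toFun ((2 : ℝ) ^ (-j + 1) • ξ) := fun j => by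
    rw [phiHatJ, phiHat, smul_smul, ← zpow_one_add₀ (two_ne_zero), add_comm]
  induction J with
  | zero => simp [e]
  | succ J ih =>
    have h : Finset.Icc (-((J + 1 : ℕ) : ℤ)) ((J + 1 : ℕ) : ℤ)
        = insert (-((J + 1 : ℕ) : ℤ)) (insert ((J + 1 : ℕ) : ℤ) (Finset.Icc (-(J : ℤ)) J)) := by
      ext x
      simp only [Finset.mem_Icc, Finset.mem_insert]
      omega
    rw [h, Finset.sum_insert (by simp; omega), Finset.sum_insert (by simp), ih, e, e]
    have e1 : (2 : ℝ) ^ (-((J + 1 : ℕ) : ℤ)) = ((2 : ℝ) ^ (J + 1))⁻¹ := by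
      rw [zpow_neg, zpow_natCast]
    have e2 : (2 : ℝ) ^ (-((J + 1 : ℕ) : ℤ) + 1) = ((2 : ℝ) ^ J)⁻¹ := by
      rw [← zpow_natCast, ← zpow_neg]; congr 1; push_cast; ring
    have e3 : (2 : ℝ) ^ (- -((J + 1 : ℕ) : ℤ)) = (2 : ℝ) ^ (J + 1) := by
      rw [neg_neg, zpow_natCast]
    have e4 : (2 : ℝ) ^ (- -((J + 1 : ℕ) : ℤ) + 1) = (2 : ℝ) ^ (J + 1 + 1) := by
      rw [neg_neg, ← zpow_natCast]; congr 1
    rw [e1, e2, e3, e4]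
    ring

theorem moderate_phiHatJ (j : ℤ) :
    Moderate fun ξ : Eu n => (ψ.phiHatJ j ((2 * Real.pi) • ξ) : ℂ) := by
  refine ⟨fun x _ => (ψ.contDiff_phiHatJ j).contDiffAt, fun k => ?_⟩
  set Φ := (ψ.hasCompactSupport_phiHatJ j).toSchwartzMap (ψ.contDiff_phiHatJ j)
  refine ⟨SchwartzMap.seminorm ℝ 0 k Φ, 0, fun x _ => ?_⟩
  rw [pow_zero, mul_one]
  exact Φ.norm_iteratedFDeriv_le_seminorm ℝ k x

/-- The dyadic block `Δ_j` as an operator on `𝒵`. -/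
noncomputable def dyadic (j : ℤ) : Z n →ₗ[ℂ] Z n := multiplier _ (ψ.moderate_phiHatJ j)

/-- Calderón's reproducing formula on `𝒵`: the partial sums telescope to `1` minus the remainder,
whose product with the flat function `𝓕 g` tends to `0` in `𝒮`. Continuity of the inverse Fourier
transform and of `f` then gives the limit. -/
theorem tendsto_sum_dyadic (f : ZDual n) (g : Z n) :
    Tendsto (fun J : ℕ => ∑ j ∈ Finset.Icc (-(J : ℤ)) J, f (ψ.dyadic j g)) atTop (𝓝 (f g)) := by
  have hflat := flat_of_iteratedFDeriv_eq_zero _ g.2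
  set D : ℕ → 𝓢(Eu n, ℂ) := fun J =>
    (hflat.moderate_mul (ψ.moderate_remainder J)).toSchwartz with hDdef
  have hDv : ∀ J ξ, D J ξ = ψ.remainder J ξ * (𝓕 (g : 𝓢(Eu n, ℂ)) : 𝓢(Eu n, ℂ)) ξ := fun J ξ => rfl
  have hD : Tendsto D atTop (𝓝 0) := by
    rw [(schwartz_withSeminorms ℂ (Eu n) ℂ).tendsto_nhds]
    intro i ε hε
    obtain ⟨C, hC0, hC⟩ := ψ.norm_remainder_mul_le hflat i.1 i.2
    have hlim : Tendsto (fun J : ℕ => C * ((2 : ℝ) ^ J)⁻¹) atTop (𝓝 0) := by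
      have := (tendsto_pow_atTop_nhds_zero_of_lt_one (r := (2 : ℝ)⁻¹) (by norm_num)
        (by norm_num)).const_mul C
      simpa [inv_pow] using this
    filter_upwards [hlim.eventually (gt_mem_nhds hε)] with J hJ
    refine lt_of_le_of_lt ?_ hJ
    rw [sub_zero]
    exact SchwartzMap.seminorm_le_bound ℂ _ _ _ (by positivity) fun ξ => hC J ξ
  have hsum : ∀ J : ℕ, ((∑ j ∈ Finset.Icc (-(J : ℤ)) J, ψ.dyadic j g : Z n) : 𝓢(Eu n, ℂ))
      = (g : 𝓢(Eu n, ℂ)) - 𝓕⁻ (D J) := by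
    intro J
    have hF : ∀ (s : Finset ℤ) (ξ : Eu n),
        (𝓕 ((∑ j ∈ s, ψ.dyadic j g : Z n) : 𝓢(Eu n, ℂ)) : 𝓢(Eu n, ℂ)) ξ
          = (∑ j ∈ s, (ψ.phiHatJ j ((2 * Real.pi) • ξ) : ℂ))
            * (𝓕 (g : 𝓢(Eu n, ℂ)) : 𝓢(Eu n, ℂ)) ξ := by
      intro s ξ
      induction s using Finset.induction_on with
      | empty => simp [FourierTransform.fourier_zero]
      | insert j s hj ih =>
        rw [Finset.sum_insert hj, Finset.sum_insert hj, Submodule.coe_add,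
          FourierTransform.fourier_add, add_apply, ih, add_mul, dyadic, fourier_multiplier]
    refine eq_of_fourier_eq fun ξ => ?_
    rw [hF, ← Complex.ofReal_sum, sum_phiHatJ, fourier_sub,
      FourierTransform.fourier_fourierInv_eq, sub_apply, hDv, remainder, symbol_apply,
      symbol_apply, smul_comm, smul_comm _ (2 * Real.pi)]
    push_cast
    ring
  have hZ : Tendsto (fun J : ℕ => ∑ j ∈ Finset.Icc (-(J : ℤ)) J, ψ.dyadic j g) atTop (𝓝 g) := by
    rw [tendsto_subtype_rng]
    simp_rw [hsum]
    have h1 : Tendsto (fun J => (𝓕⁻ (D J) : 𝓢(Eu n, ℂ))) atTop (𝓝 0) := by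
      have := ((FourierTransform.fourierInvCLM ℂ 𝓢(Eu n, ℂ)).continuous.tendsto 0).comp hD
      rwa [map_zero] at this
    simpa using tendsto_const_nhds.sub h1
  have := (f.continuous.tendsto g).comp hZ
  simpa only [Function.comp_def, map_sum] using this

end Cutoff

/-! ### Dyadic blocks and the heat semigroup -/

section Pairing

variable {n : ℕ}

theorem integral_functional_shift_of_fourier (f : ZDual n) {η : 𝓢(Eu n, ℂ)}
    (hη : ∀ x, shift η x ∈ Z n) (h : 𝓢(Eu n, ℂ)) (G : Z n)
    (hG : ∀ ξ, (𝓕 (G : 𝓢(Eu n, ℂ)) : 𝓢(Eu n, ℂ)) ξ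
      = (𝓕 h : 𝓢(Eu n, ℂ)) ξ * (𝓕 η : 𝓢(Eu n, ℂ)) ξ) :
    ∫ y, h y * f ⟨shift η y, hη y⟩ = f G := by
  have hGc : (G : 𝓢(Eu n, ℂ)) = SchwartzMap.convolution (ContinuousLinearMap.mul ℂ ℂ) h η := by
    refine eq_of_fourier_eq fun ξ => ?_
    rw [hG, SchwartzMap.fourier_convolution, SchwartzMap.pairing_apply_apply]
    rfl
  refine integral_functional_shift f hη h G fun z => ?_
  rw [hGc, SchwartzMap.convolution_apply]
  rfl

theorem fourier_shift_reflect (θ : 𝓢(Eu n, ℂ)) (x ξ : Eu n) :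
    (𝓕 (shift (reflect θ) x) : 𝓢(Eu n, ℂ)) ξ
      = Real.fourierChar (-inner ℝ x ξ) • (𝓕 θ : 𝓢(Eu n, ℂ)) (-ξ) := by
  rw [SchwartzMap.fourier_coe, SchwartzMap.fourier_coe, Real.fourier_eq, Real.fourier_eq,
    ← integral_sub_left_eq_self _ volume x, Circle.smul_def, ← integral_smul]
  congr 1 with y
  rw [shift_reflect_apply, sub_sub_cancel, inner_sub_left, inner_neg_right,
    show -(inner ℝ x ξ - inner ℝ y ξ) = -inner ℝ x ξ + - -inner ℝ y ξ by ring,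
    AddChar.map_add_eq_mul, mul_smul, Circle.smul_def]

theorem fourier_reflect (θ : 𝓢(Eu n, ℂ)) (ξ : Eu n) :
    (𝓕 (reflect θ) : 𝓢(Eu n, ℂ)) ξ = (𝓕 θ : 𝓢(Eu n, ℂ)) (-ξ) := by
  have h := fourier_shift_reflect θ 0 ξ
  have h0 : shift (reflect θ) 0 = reflect θ := by
    ext x; simp [shift]
  rw [h0] at h
  simpa using h

theorem shift_reflect_mem {θ : 𝓢(Eu n, ℂ)} {r : ℝ} (hr : 0 < r)
    (hθ : ∀ ξ, ‖ξ‖ < r → (𝓕 θ : 𝓢(Eu n, ℂ)) ξ = 0) (x : Eu n) : shift (reflect θ) x ∈ Z n := by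
  intro k
  have h : ((𝓕 (shift (reflect θ) x) : 𝓢(Eu n, ℂ)) : Eu n → ℂ) =ᶠ[nhds 0] fun _ => 0 := by
    filter_upwards [Metric.ball_mem_nhds (0 : Eu n) hr] with ξ hξ
    rw [fourier_shift_reflect, hθ, smul_zero]
    simpa using hξ
  rw [(h.iteratedFDeriv ℝ k).eq_of_nhds, iteratedFDeriv_fun_zero]
  rfl

end Pairing

namespace Cutoff

variable {n : ℕ} (ψ : Cutoff n)

/-- `φ̂` in Mathlib's frequency variable. -/
noncomputable def annulus : 𝓢(Eu n, ℂ) :=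
  (ψ.hasCompactSupport_phiHatJ 0).toSchwartzMap (ψ.contDiff_phiHatJ 0)

theorem annulus_dilate (j : ℤ) (ξ : Eu n) :
    ψ.annulus (((2 : ℝ) ^ j)⁻¹ • ξ) = (ψ.phiHatJ j ((2 * Real.pi) • ξ) : ℂ) := by
  change (ψ.phiHatJ 0 ((2 * Real.pi) • (((2 : ℝ) ^ j)⁻¹ • ξ)) : ℂ) = _
  rw [phiHatJ, phiHatJ, neg_zero, zpow_zero, one_smul, smul_comm, zpow_neg]

theorem annulus_eq_zero {ξ : Eu n} (h : 2 ≤ ‖(2 * Real.pi) • ξ‖ ∨ 2 * ‖(2 * Real.pi) • ξ‖ ≤ 1) :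
    ψ.annulus ξ = 0 := by
  change (ψ.phiHatJ 0 ((2 * Real.pi) • ξ) : ℂ) = 0
  rcases h with h | h
  · rw [ψ.phiHatJ_eq_zero_of_le 0 (by simpa using h), Complex.ofReal_zero]
  · rw [ψ.phiHatJ_eq_zero_of_ge 0 (by simpa using h), Complex.ofReal_zero]

theorem phiHatJ_neg (j : ℤ) (ξ : Eu n) : ψ.phiHatJ j (-ξ) = ψ.phiHatJ j ξ := by
  unfold phiHatJ phiHat
  rw [smul_neg, smul_neg, ψ.radial (-_) _ (norm_neg _), ψ.radial (-_) _ (norm_neg _)]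

/-- A function supported in an annulus and equal to `1` on the support of `φ̂`. -/
noncomputable def fatAnnulus : 𝓢(Eu n, ℂ) :=
  SchwartzMap.compCLMOfContinuousLinearEquiv ℂ
    (ContinuousLinearEquiv.smulLeft (Units.mk0 (2⁻¹ : ℝ) (by norm_num))) ψ.symbol
  - SchwartzMap.compCLMOfContinuousLinearEquiv ℂ
    (ContinuousLinearEquiv.smulLeft (Units.mk0 (4 : ℝ) (by norm_num))) ψ.symbol

theorem fatAnnulus_apply (ξ : Eu n) :
    ψ.fatAnnulus ξ = (ψ.toFun ((2 * Real.pi) • ((2⁻¹ : ℝ) • ξ)) : ℂ)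
      - (ψ.toFun ((2 * Real.pi) • ((4 : ℝ) • ξ)) : ℂ) := rfl

theorem norm_bounds_of_annulus_ne_zero {ξ : Eu n} (h : ψ.annulus ξ ≠ 0) :
    (4 * Real.pi)⁻¹ ≤ ‖ξ‖ ∧ ‖ξ‖ ≤ 1 := by
  have h1 := mt ψ.annulus_eq_zero h
  have hpi := Real.pi_gt_three
  rw [not_or, not_le, not_le, norm_smul, Real.norm_of_nonneg (by positivity)] at h1
  refine ⟨(inv_le_iff_one_le_mul₀ (by positivity)).2 (by nlinarith), ?_⟩
  nlinarith [norm_nonneg ξ]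

theorem norm_bounds_of_fatAnnulus_ne_zero {ξ : Eu n} (h : ψ.fatAnnulus ξ ≠ 0) :
    (8 * Real.pi)⁻¹ ≤ ‖ξ‖ ∧ ‖ξ‖ ≤ 1 := by
  have hpi := Real.pi_gt_three
  have e : ∀ c : ℝ, 0 ≤ c → ‖(2 * Real.pi) • (c • ξ)‖ = 2 * Real.pi * (c * ‖ξ‖) := fun c hc => by
    rw [norm_smul, norm_smul, Real.norm_of_nonneg (by positivity), Real.norm_of_nonneg hc]
  by_contra hc
  rw [not_and_or, not_le, not_le] at hc
  refine h ?_
  rw [fatAnnulus_apply]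
  rcases hc with hc | hc
  · rw [← one_div, lt_div_iff₀ (by positivity)] at hc
    rw [ψ.eq_one, ψ.eq_one, sub_self]
    · rw [e _ (by norm_num)]; linarith
    · rw [e _ (by norm_num)]; nlinarith [norm_nonneg ξ]
  · rw [ψ.eq_zero, ψ.eq_zero, sub_self]
    · rw [e _ (by norm_num)]; nlinarith
    · rw [e _ (by norm_num)]; nlinarith

/-- On the support of `φ̂` the first term `ψ̂(ξ/2)` is `1` and the second, `ψ̂(4ξ)`, is `0`. It
allows the heat factor to be applied to a block that is already localised. -/
theorem fatAnnulus_mul_annulus (ξ : Eu n) : ψ.fatAnnulus ξ * ψ.annulus ξ = ψ.annulus ξ := by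
  by_cases h : ψ.annulus ξ = 0
  · rw [h, mul_zero]
  · have h1 := mt ψ.annulus_eq_zero h
    rw [not_or, not_le, not_le] at h1
    rw [fatAnnulus_apply, ψ.eq_one, ψ.eq_zero, Complex.ofReal_one, Complex.ofReal_zero, sub_zero,
      one_mul]
    · rw [smul_comm, norm_smul, Real.norm_of_nonneg (by norm_num)]
      linarith
    · rw [smul_comm, norm_smul, Real.norm_of_nonneg (by norm_num)]
      linarith

theorem fourier_kernel (j : ℤ) (ξ : Eu n) :
    (𝓕 (ψ.kernel j) : 𝓢(Eu n, ℂ)) ξ = ψ.annulus (((2 : ℝ) ^ j)⁻¹ • ξ) := by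
  rw [annulus_dilate, kernel, FourierTransform.fourier_fourierInv_eq]
  rfl

theorem annulus_dilate_neg (j : ℤ) (ξ : Eu n) :
    ψ.annulus (((2 : ℝ) ^ j)⁻¹ • (-ξ)) = ψ.annulus (((2 : ℝ) ^ j)⁻¹ • ξ) := by
  rw [annulus_dilate, annulus_dilate, smul_neg, phiHatJ_neg]

theorem annulus_dilate_eq_zero (j : ℤ) {ξ : Eu n} (h : ‖ξ‖ < (2 : ℝ) ^ j * (4 * Real.pi)⁻¹) :
    ψ.annulus (((2 : ℝ) ^ j)⁻¹ • ξ) = 0 := by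
  by_contra hc
  have h1 := (ψ.norm_bounds_of_annulus_ne_zero hc).1
  rw [norm_smul, Real.norm_of_nonneg (by positivity), inv_mul_eq_div,
    le_div_iff₀ (by positivity)] at h1
  linarith

theorem shift_reflect_mem_of_annulus {θ : 𝓢(Eu n, ℂ)} {j : ℤ} {m : Eu n → ℂ}
    (hθ : ∀ ξ, (𝓕 θ : 𝓢(Eu n, ℂ)) ξ = ψ.annulus (((2 : ℝ) ^ j)⁻¹ • ξ) * m ξ) (x : Eu n) :
    shift (reflect θ) x ∈ Z n :=
  shift_reflect_mem (r := (2 : ℝ) ^ j * (4 * Real.pi)⁻¹) (by positivity)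
    (fun ξ hξ => by rw [hθ, ψ.annulus_dilate_eq_zero j hξ, zero_mul]) x

theorem heatSymbol_of_pos {α t : ℝ} (ht : 0 < t) (ξ : Eu n) :
    heatSymbol α t ξ = (Real.exp (-t * ‖(2 * Real.pi) • ξ‖ ^ (2 * α)) : ℝ) := by
  rw [heatSymbol, max_eq_left ht.le]

theorem continuous_block (j : ℤ) (f : ZDual n) : Continuous (ψ.block j f) :=
  continuous_functional_shift f (η := reflect (ψ.kernel j)) (ψ.translate_mem j)

/-- Test `u` against `k(x - ·)`, which lies in `𝒵` because its spectrum avoids `0`. The heat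
multiplier cancels the growing exponential and leaves `φ_j(x - ·)`. Any representative `u` will do,
so its possible non-uniqueness does not matter. -/
theorem block_eq_convolution {α t : ℝ} (ht : 0 < t) (j : ℤ) (f : ZDual n) {k : 𝓢(Eu n, ℂ)}
    (hk : ∀ ξ, (𝓕 k : 𝓢(Eu n, ℂ)) ξ = ψ.annulus (((2 : ℝ) ^ j)⁻¹ • ξ)
      * (Real.exp (t * ‖(2 * Real.pi) • ξ‖ ^ (2 * α)) : ℝ)) {u : Eu n → ℂ}
    (hu : ∀ g : Z n, ∫ x, u x * (g : 𝓢(Eu n, ℂ)) x = heat α t f g) (x : Eu n) :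
    ψ.block j f x = ∫ y, k (x - y) * u y := by
  have hmem := ψ.shift_reflect_mem_of_annulus hk x
  have h := hu ⟨_, hmem⟩
  have e : multiplier (heatSymbol α t) (moderate_heatSymbol α t) ⟨_, hmem⟩
      = ⟨ψ.translate j x, ψ.translate_mem j x⟩ := by
    apply Subtype.ext
    refine eq_of_fourier_eq fun ξ => ?_
    rw [fourier_multiplier, heatSymbol_of_pos ht, fourier_shift_reflect, hk]
    change _ = (𝓕 (shift (reflect (ψ.kernel j)) x) : 𝓢(Eu n, ℂ)) ξ
    rw [fourier_shift_reflect, fourier_kernel, smul_neg (2 * Real.pi), norm_neg, Circle.smul_def,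
      Circle.smul_def, smul_eq_mul, smul_eq_mul]
    rw [mul_left_comm, mul_left_comm _ (ψ.annulus _), ← Complex.ofReal_mul, ← Real.exp_add,
      neg_mul, neg_add_cancel, Real.exp_zero, Complex.ofReal_one, mul_one]
  have h2 : heat α t f ⟨_, hmem⟩ = ψ.block j f x := by
    change f (multiplier (heatSymbol α t) (moderate_heatSymbol α t) ⟨_, hmem⟩) = _
    rw [e]
    rfl
  rw [← h2, ← h]
  refine integral_congr_ae (Eventually.of_forall fun y => ?_)
  simp only [shift_reflect_apply]
  exact mul_comm _ _

theorem exists_eLpNorm_block_le {α : ℝ} (hα : 0 < α) {p : ℝ≥0∞} (hp : 1 ≤ p) (T : ℝ) :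
    ∃ C : ℝ≥0, ∀ (f : ZDual n) (j : ℤ) (t : ℝ), 0 < t → t * ((2 : ℝ) ^ (2 * α)) ^ j ≤ T →
      eLpNorm (ψ.block j f) p volume ≤ C * distNorm p (heat α t f) := by
  obtain ⟨C, hC⟩ := exists_inverse_heat_kernel α ψ.annulus (r := (4 * Real.pi)⁻¹)
    (by positivity) (fun x hx => ψ.norm_bounds_of_annulus_ne_zero hx) hα T
  -- A nonzero constant can be divided out, which moves the bound inside the infimum that defines
  -- `distNorm`.
  refine ⟨C + 1, fun f j t ht hT => ?_⟩
  obtain ⟨k, hk, hk1⟩ := hC j t ht hT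
  have h0 : ((C + 1 : ℝ≥0) : ℝ≥0∞) ≠ 0 := by simp
  rw [mul_comm, ← ENNReal.div_le_iff h0 ENNReal.coe_ne_top]
  refine le_iInf₂ fun u hu => ?_
  rw [ENNReal.div_le_iff h0 ENNReal.coe_ne_top, mul_comm]
  have e : ψ.block j f = fun x => ∫ y, k (x - y) * u y :=
    funext fun x => ψ.block_eq_convolution ht j f hk hu.2 x
  rw [e]
  refine (eLpNorm_convolution_le k.continuous hu.1.1 hp).trans ?_
  gcongr
  exact hk1.trans (by simp)

/-- The function `V` represents `S_α(t) Δ_j f`: it is `x ↦ f(θ(x - ·))`, where `θ` has symbol `φ̂_j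
exp (-t|ξ|^{2α})`. Since `θ = K * φ_j` with `K` the heat kernel cut off to the larger annulus, `V =
K * Δ_j f` and Young's inequality gives the norm bound. -/
theorem exists_heat_block {α : ℝ} (hα : 0 < α) {p : ℝ≥0∞} (hp : 1 ≤ p) (M : ℕ) :
    ∃ C : ℝ≥0, ∀ (f : ZDual n) (j : ℤ) (t : ℝ), 0 < t → ∃ V : Eu n → ℂ, Continuous V ∧
      eLpNorm V p volume ≤ C * ENNReal.ofReal (min 1 ((t * ((2 : ℝ) ^ (2 * α)) ^ j) ^ M)⁻¹)
        * eLpNorm (ψ.block j f) p volume ∧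
      ∀ g : Z n, ∫ x, (g : 𝓢(Eu n, ℂ)) x * V x
        = f (ψ.dyadic j (multiplier (heatSymbol α t) (moderate_heatSymbol α t) g)) := by
  obtain ⟨_, hA⟩ := exists_heat_kernel α ψ.annulus (r := (4 * Real.pi)⁻¹)
    (by positivity) (fun x hx => ψ.norm_bounds_of_annulus_ne_zero hx) hα M
  obtain ⟨C, hC⟩ := exists_heat_kernel α ψ.fatAnnulus (r := (8 * Real.pi)⁻¹)
    (by positivity) (fun x hx => ψ.norm_bounds_of_fatAnnulus_ne_zero hx) hα M
  refine ⟨C, fun f j t ht => ?_⟩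
  obtain ⟨θ, hθ, -⟩ := hA j t ht
  obtain ⟨K, hK, hK1⟩ := hC j t ht
  have hmem := ψ.shift_reflect_mem_of_annulus hθ
  refine ⟨fun x => f ⟨_, hmem x⟩, continuous_functional_shift f hmem, ?_, fun g => ?_⟩
  · have e : (fun x => f ⟨_, hmem x⟩) = fun x => ∫ y, K (x - y) * ψ.block j f y := by
      funext x
      have h := integral_functional_shift_of_fourier f (η := reflect (ψ.kernel j))
        (ψ.translate_mem j) (shift (reflect K) x) ⟨_, hmem x⟩ fun ξ => by
          rw [fourier_shift_reflect, fourier_shift_reflect, fourier_reflect, fourier_kernel, hθ, hK,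
            smul_mul_assoc, mul_right_comm, fatAnnulus_mul_annulus]
      rw [← h]
      refine integral_congr_ae (Eventually.of_forall fun y => ?_)
      simp only [shift_reflect_apply]
      rfl
    rw [e]
    refine (eLpNorm_convolution_le K.continuous
      (ψ.continuous_block j f).aestronglyMeasurable hp).trans ?_
    gcongr
  · refine integral_functional_shift_of_fourier f hmem (g : 𝓢(Eu n, ℂ)) _ fun ξ => ?_
    rw [dyadic, fourier_multiplier, fourier_multiplier, fourier_reflect, hθ, annulus_dilate_neg,
      annulus_dilate, smul_neg (2 * Real.pi), norm_neg, heatSymbol_of_pos ht]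
    ring

/-- When the right side is finite, the functions representing `S_α(t) Δ_j f` sum absolutely in
`L^p`. The sum represents `S_α(t) f`, because pairing with `g` is continuous on `L^p` and the dyadic
partial sums converge weakly. -/
theorem distNorm_heat_le {α : ℝ} (hα : 0 < α) {p : ℝ≥0∞} (hp : 1 ≤ p) (M : ℕ) :
    ∃ C : ℝ≥0, ∀ (f : ZDual n) (t : ℝ), 0 < t → distNorm p (heat α t f)
      ≤ ∑' j : ℤ, C * ENNReal.ofReal (min 1 ((t * ((2 : ℝ) ^ (2 * α)) ^ j) ^ M)⁻¹)
        * eLpNorm (ψ.block j f) p volume := by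
  obtain ⟨C, hC⟩ := ψ.exists_heat_block hα hp M
  refine ⟨C, fun f t ht => ?_⟩
  choose V hVc hVn hVg using fun j => hC f j t ht
  refine le_trans ?_ (ENNReal.tsum_le_tsum hVn)
  by_cases htop : ∑' j, eLpNorm (V j) p volume = ⊤
  · rw [htop]; exact le_top
  have hV : ∀ j, MemLp (V j) p volume := fun j =>
    ⟨(hVc j).aestronglyMeasurable, (ENNReal.ne_top_of_tsum_ne_top htop j).lt_top⟩
  have : Fact (1 ≤ p) := ⟨hp⟩
  set v : ℤ → Lp ℂ p (volume : Measure (Eu n)) := fun j => (hV j).toLp with hv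
  have hve : ∀ j, ‖v j‖ₑ = eLpNorm (V j) p volume := fun j => by
    rw [hv, Lp.enorm_def]
    exact eLpNorm_congr_ae (hV j).coeFn_toLp
  have hsum : Summable v := by
    refine Summable.of_norm ?_
    have := ENNReal.summable_toReal htop
    simp_rw [← hve, toReal_enorm] at this
    exact this
  set U : Lp ℂ p (volume : Measure (Eu n)) := ∑' j, v j
  have hU : eLpNorm U p volume ≤ ∑' j, eLpNorm (V j) p volume := by
    rw [← Lp.enorm_def]
    simp_rw [← hve]
    exact enorm_tsum_le_tsum_enorm
  refine le_trans (iInf₂_le (U : Eu n → ℂ) ⟨Lp.memLp U, fun g => ?_⟩) hU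
  set h := multiplier (heatSymbol α t) (moderate_heatSymbol α t) g
  have hL : HasSum (fun j => f (ψ.dyadic j h)) (∫ x, (g : 𝓢(Eu n, ℂ)) x * U x) := by
    -- In `ℝ≥0∞` the expression `(1 - p⁻¹)⁻¹` is the conjugate exponent at both endpoints too: `⊤`
    -- for `p = 1` and `1` for `p = ⊤`.
    have : Fact (1 ≤ (1 - p⁻¹)⁻¹) := by simp [fact_iff]
    have : ENNReal.HolderConjugate p (1 - p⁻¹)⁻¹ := ENNReal.HolderConjugate.inv_one_sub_inv' hp
    have h1 := hsum.hasSum.mapL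
      (((ContinuousLinearMap.mul ℂ ℂ).flip.lpPairing volume p (1 - p⁻¹)⁻¹).flip
        ((g : 𝓢(Eu n, ℂ)).toLp (1 - p⁻¹)⁻¹ volume))
    have h2 : ∀ w : Lp ℂ p (volume : Measure (Eu n)),
        ((ContinuousLinearMap.mul ℂ ℂ).flip.lpPairing volume p (1 - p⁻¹)⁻¹).flip
          ((g : 𝓢(Eu n, ℂ)).toLp (1 - p⁻¹)⁻¹ volume) w = ∫ x, (g : 𝓢(Eu n, ℂ)) x * w x := by
      intro w
      rw [ContinuousLinearMap.flip_apply, ContinuousLinearMap.lpPairing_eq_integral]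
      refine integral_congr_ae ?_
      filter_upwards [(g : 𝓢(Eu n, ℂ)).coeFn_toLp (1 - p⁻¹)⁻¹ volume] with x hx
      rw [hx]
      rfl
    simp_rw [h2] at h1
    have h3 : ∀ j, ∫ x, (g : 𝓢(Eu n, ℂ)) x * v j x = f (ψ.dyadic j h) := fun j => by
      rw [← hVg]
      refine integral_congr_ae ?_
      filter_upwards [(hV j).coeFn_toLp] with x hx
      rw [hx]
    simp_rw [h3] at h1
    exact h1
  -- Unconditional summation over `ℤ` is restricted to the symmetric intervals used in the
  -- reproducing formula.
  have hT := hL.comp (Finset.tendsto_Icc_neg (R := ℤ))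
  have := tendsto_nhds_unique hT (ψ.tendsto_sum_dyadic f h)
  simp_rw [mul_comm _ ((g : 𝓢(Eu n, ℂ)) _)]
  exact this

end Cutoff

/-! ### Comparison of dyadic sums with integrals over `(0, ∞)` -/

section Dyadic

theorem pairwise_disjoint_Ico_zpow_real {y : ℝ} (hy : 1 < y) :
    Pairwise (Function.onFun Disjoint fun k : ℤ => Ico (y ^ k) (y ^ (k + 1))) := by
  intro k l hkl
  wlog h : k < l generalizing k l
  · exact (this hkl.symm (lt_of_le_of_ne (not_lt.1 h) hkl.symm)).symm
  rw [Function.onFun, Set.disjoint_left]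
  intro x hx hx'
  have h1 : y ^ (k + 1) ≤ y ^ l := zpow_le_zpow_right₀ hy.le (by omega)
  exact absurd (hx.2.trans_le h1) (not_lt.2 hx'.1)

theorem iUnion_Ico_zpow_real {y : ℝ} (hy : 1 < y) :
    ⋃ k : ℤ, Ico (y ^ k) (y ^ (k + 1)) = Ioi 0 := by
  ext x
  rw [mem_iUnion]
  refine ⟨fun ⟨k, hk⟩ => lt_of_lt_of_le (by positivity) hk.1, fun hx => exists_mem_Ico_zpow hx hy⟩

theorem lintegral_Ioi_eq_tsum {y : ℝ} (hy : 1 < y) (F : ℝ → ℝ≥0∞) :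
    ∫⁻ t in Ioi (0 : ℝ), F t = ∑' k : ℤ, ∫⁻ t in Ico (y ^ k) (y ^ (k + 1)), F t := by
  rw [← iUnion_Ico_zpow_real hy, lintegral_iUnion (fun _ => measurableSet_Ico)
    (pairwise_disjoint_Ico_zpow_real hy)]

theorem volume_Ico_zpow {y : ℝ} (hy : 1 < y) (k : ℤ) :
    volume (Ico (y ^ k) (y ^ (k + 1))) = ENNReal.ofReal (y ^ k * (y - 1)) := by
  rw [Real.volume_Ico, zpow_add_one₀ (by positivity), mul_sub, mul_one]

theorem lintegral_Ico_zpow_inv_le {y : ℝ} (hy : 1 < y) (k : ℤ) :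
    ∫⁻ t in Ico (y ^ k) (y ^ (k + 1)), ENNReal.ofReal (1 / t) ≤ ENNReal.ofReal (y - 1) := by
  have hk : 0 < y ^ k := by positivity
  calc _ ≤ ∫⁻ _ in Ico (y ^ k) (y ^ (k + 1)), ENNReal.ofReal (1 / y ^ k) := by
        refine setLIntegral_mono measurable_const fun t ht => ?_
        exact ENNReal.ofReal_le_ofReal (one_div_le_one_div_of_le hk ht.1)
    _ = _ := by
        rw [setLIntegral_const, volume_Ico_zpow hy, ← ENNReal.ofReal_mul (by positivity)]
        congr 1
        field_simp

theorem le_lintegral_Ico_zpow_inv {y : ℝ} (hy : 1 < y) (k : ℤ) :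
    ENNReal.ofReal ((y - 1) / y) ≤ ∫⁻ t in Ico (y ^ k) (y ^ (k + 1)), ENNReal.ofReal (1 / t) := by
  have hk : 0 < y ^ k := by positivity
  calc _ = ∫⁻ _ in Ico (y ^ k) (y ^ (k + 1)), ENNReal.ofReal (1 / y ^ (k + 1)) := by
        rw [setLIntegral_const, volume_Ico_zpow hy, ← ENNReal.ofReal_mul (by positivity),
          zpow_add_one₀ (by positivity)]
        congr 1
        field_simp
    _ ≤ _ := by
        refine setLIntegral_mono (by fun_prop) fun t ht => ?_
        exact ENNReal.ofReal_le_ofReal (one_div_le_one_div_of_le (hk.trans_le ht.1) ht.2.le)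

theorem lintegral_Ioi_le_tsum {y : ℝ} (hy : 1 < y) {H : ℝ → ℝ≥0∞} {G : ℤ → ℝ≥0∞}
    (h : ∀ k, ∀ t ∈ Ico (y ^ k) (y ^ (k + 1)), H t ≤ G k) {q : ℝ} (hq : 0 ≤ q) :
    ∫⁻ t in Ioi (0 : ℝ), H t ^ q * ENNReal.ofReal (1 / t)
      ≤ ENNReal.ofReal (y - 1) * ∑' k, G k ^ q := by
  rw [lintegral_Ioi_eq_tsum hy, ← ENNReal.tsum_mul_left]
  refine ENNReal.tsum_le_tsum fun k => ?_
  calc _ ≤ ∫⁻ t in Ico (y ^ k) (y ^ (k + 1)), G k ^ q * ENNReal.ofReal (1 / t) := by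
        refine setLIntegral_mono (by fun_prop) fun t ht => ?_
        gcongr
        exact h k t ht
    _ = G k ^ q * ∫⁻ t in Ico (y ^ k) (y ^ (k + 1)), ENNReal.ofReal (1 / t) :=
        lintegral_const_mul _ (by fun_prop)
    _ ≤ _ := by
        rw [mul_comm]
        gcongr
        exact lintegral_Ico_zpow_inv_le hy k

/-- Each interval has `dt/t` measure at least `(y - 1)/y`. Only the constants `G k` need to be
measurable, so nothing is required of `H`, here the norm of the heat flow as a function of time. -/
theorem tsum_le_lintegral_Ioi {y : ℝ} (hy : 1 < y) {H : ℝ → ℝ≥0∞} {G : ℤ → ℝ≥0∞}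
    (h : ∀ k, ∀ t ∈ Ico (y ^ k) (y ^ (k + 1)), G k ≤ H t) {q : ℝ} (hq : 0 ≤ q) :
    ENNReal.ofReal ((y - 1) / y) * ∑' k, G k ^ q
      ≤ ∫⁻ t in Ioi (0 : ℝ), H t ^ q * ENNReal.ofReal (1 / t) := by
  rw [lintegral_Ioi_eq_tsum hy, ← ENNReal.tsum_mul_left]
  refine ENNReal.tsum_le_tsum fun k => ?_
  calc _ ≤ G k ^ q * ∫⁻ t in Ico (y ^ k) (y ^ (k + 1)), ENNReal.ofReal (1 / t) := by
        rw [mul_comm]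
        gcongr
        exact le_lintegral_Ico_zpow_inv hy k
    _ = ∫⁻ t in Ico (y ^ k) (y ^ (k + 1)), G k ^ q * ENNReal.ofReal (1 / t) :=
        (lintegral_const_mul _ (by fun_prop)).symm
    _ ≤ _ := by
        refine setLIntegral_mono' measurableSet_Ico fun t ht => ?_
        gcongr
        exact h k t ht

theorem tsum_pow_natAbs_lt_top {ρ : ℝ} (h0 : 0 ≤ ρ) (h1 : ρ < 1) :
    ∑' m : ℤ, ENNReal.ofReal (ρ ^ m.natAbs) < ⊤ := by
  have hs : Summable fun m : ℤ => ρ ^ m.natAbs := by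
    refine Summable.of_nat_of_neg ?_ ?_
    · simpa using summable_geometric_of_lt_one h0 h1
    · simpa using summable_geometric_of_lt_one h0 h1
  rw [← ENNReal.ofReal_tsum_of_nonneg (fun _ => by positivity) hs]
  exact ENNReal.ofReal_lt_top

/-- Schur's test for counting measure: every row and every column of `κ (j + k)` is a reindexing of
`κ`. -/
theorem tsum_convolution_rpow_le (κ W : ℤ → ℝ≥0∞) {q : ℝ} (hq : 1 ≤ q) :
    ∑' k : ℤ, (∑' j : ℤ, κ (j + k) * W j) ^ q ≤ (∑' m, κ m) ^ q * ∑' j, W j ^ q := by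
  have h := lintegral_schur (μ := (Measure.count : Measure ℤ)) (ν := (Measure.count : Measure ℤ))
    (K := fun k j => κ (j + k)) (u := W) (A := ∑' m, κ m) (measurable_of_countable _)
    (measurable_of_countable _).aemeasurable ?_ ?_ hq
  · simpa only [lintegral_count] using h
  · intro k
    rw [lintegral_count]
    exact (Equiv.tsum_eq (Equiv.addRight k) κ).le
  · intro j
    rw [lintegral_count]
    exact (Equiv.tsum_eq (Equiv.addLeft j) κ).le

/-- For `τ ≥ 1` the condition `M ≥ 2a` leaves at most `τ^{-a}`; for `τ < 1` the power `τ^a` itself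
decays. The factor `y ^ a` pays for the upper endpoint `y ^ (m + 1)` when `m < 0`. -/
theorem rpow_mul_min_le {y a : ℝ} (hy : 1 < y) (ha : 0 < a) {M : ℕ} (hM : 2 * a ≤ M) {τ : ℝ}
    {m : ℤ} (h1 : y ^ m ≤ τ) (h2 : τ < y ^ (m + 1)) :
    τ ^ a * min 1 (τ ^ M)⁻¹ ≤ y ^ a * (y ^ (-a)) ^ m.natAbs := by
  have hy0 : 0 < y := by linarith
  have hτ : 0 < τ := lt_of_lt_of_le (by positivity) h1
  have hya : 1 ≤ y ^ a := Real.one_le_rpow hy.le ha.le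
  rcases le_or_gt 0 m with hm | hm
  · obtain ⟨k, rfl⟩ := Int.eq_ofNat_of_zero_le hm
    have hτ1 : 1 ≤ τ := (one_le_zpow₀ hy.le hm).trans h1
    have h3 : τ ^ a * min 1 (τ ^ M)⁻¹ ≤ (τ ^ a)⁻¹ := by
      refine (mul_le_mul_of_nonneg_left (min_le_right _ _) (by positivity)).trans ?_
      rw [← Real.rpow_natCast, ← Real.rpow_neg hτ.le, ← Real.rpow_neg hτ.le, ← Real.rpow_add hτ]
      exact Real.rpow_le_rpow_of_exponent_le hτ1 (by linarith)
    refine h3.trans ?_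
    rw [Int.natAbs_natCast, ← Real.rpow_mul_natCast hy0.le, mul_comm (-a), mul_neg, Real.rpow_neg hy0.le,
      Real.rpow_natCast_mul hy0.le]
    refine le_trans ?_ (le_mul_of_one_le_left (by positivity) hya)
    rw [zpow_natCast] at h1
    gcongr
  · obtain ⟨k, rfl⟩ := Int.eq_negSucc_of_lt_zero hm
    have h3 : τ ^ a * min 1 (τ ^ M)⁻¹ ≤ τ ^ a :=
      mul_le_of_le_one_right (by positivity) (min_le_left _ _)
    refine h3.trans ((Real.rpow_le_rpow hτ.le h2.le ha.le).trans (le_of_eq ?_))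
    rw [Int.natAbs_negSucc, ← Real.rpow_mul_natCast hy0.le, ← Real.rpow_add hy0, ← Real.rpow_intCast,
      ← Real.rpow_mul hy0.le]
    congr 1
    rw [Int.negSucc_eq]
    push_cast
    ring

end Dyadic

/-! ### The two implications -/

namespace Cutoff

variable {n : ℕ} (ψ : Cutoff n)

theorem two_rpow_eq {α s : ℝ} (hα : 0 < α) (j : ℤ) :
    (2 : ℝ) ^ (j * s) = (((2 : ℝ) ^ (2 * α)) ^ (-j)) ^ (-s / (2 * α)) := by
  rw [← Real.rpow_intCast, ← Real.rpow_mul (by positivity), ← Real.rpow_mul (by positivity)]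
  congr 1
  push_cast
  field_simp

theorem exists_block_le_heat {α s : ℝ} (hα : 0 < α) (hs : s < 0) {p : ℝ≥0∞} (hp : 1 ≤ p) :
    ∃ C : ℝ≥0, ∀ (f : ZDual n) (k : ℤ),
      ∀ t ∈ Ico (((2 : ℝ) ^ (2 * α)) ^ k) (((2 : ℝ) ^ (2 * α)) ^ (k + 1)),
        ENNReal.ofReal ((2 : ℝ) ^ (((-k : ℤ) : ℝ) * s)) * eLpNorm (ψ.block (-k) f) p volume
          ≤ C * (ENNReal.ofReal (t ^ (-s / (2 * α))) * distNorm p (heat α t f)) := by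
  set y : ℝ := (2 : ℝ) ^ (2 * α)
  have hy0 : 0 < y := by positivity
  -- For `t` in the interval of index `k` and the block `-k`, `τ = t · y ^ (-k)` lies in `[1, y)`,
  -- so the threshold is `y`.
  obtain ⟨C, hC⟩ := ψ.exists_eLpNorm_block_le hα hp y
  refine ⟨C, fun f k t ht => ?_⟩
  have hk : 0 < y ^ k := by positivity
  have ht0 : 0 < t := hk.trans_le ht.1
  have hT : t * y ^ (-k) ≤ y := by
    have := ht.2.le
    rw [zpow_add_one₀ hy0.ne'] at this
    rw [zpow_neg, ← div_eq_mul_inv, div_le_iff₀ hk]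
    linarith
  rw [two_rpow_eq hα, neg_neg, mul_left_comm]
  gcongr
  -- The exponent `-s/(2α)` is positive because `s < 0`, so the weight increases in `t` and the left
  -- endpoint `y ^ k` gives the smallest value.
  · exact (div_pos (neg_pos.2 hs) (by positivity)).le
  · exact ht.1
  · exact hC f (-k) t ht0 hT

theorem exists_heat_le_block {α s : ℝ} (hα : 0 < α) (hs : s < 0) {p : ℝ≥0∞} (hp : 1 ≤ p) :
    ∃ κ : ℤ → ℝ≥0∞, ∑' m, κ m < ⊤ ∧ ∀ (f : ZDual n) (k : ℤ),
      ∀ t ∈ Ico (((2 : ℝ) ^ (2 * α)) ^ k) (((2 : ℝ) ^ (2 * α)) ^ (k + 1)),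
        ENNReal.ofReal (t ^ (-s / (2 * α))) * distNorm p (heat α t f)
          ≤ ∑' j : ℤ, κ (j + k)
            * (ENNReal.ofReal ((2 : ℝ) ^ (j * s)) * eLpNorm (ψ.block j f) p volume) := by
  set y : ℝ := (2 : ℝ) ^ (2 * α)
  have hy0 : 0 < y := by positivity
  have hy : 1 < y := Real.one_lt_rpow (by norm_num) (by positivity)
  set a : ℝ := -s / (2 * α)
  have ha : 0 < a := div_pos (neg_pos.2 hs) (by positivity)
  obtain ⟨M, hM⟩ := exists_nat_ge (2 * a)
  obtain ⟨C, hC⟩ := ψ.distNorm_heat_le hα hp M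
  refine ⟨fun m => C * ENNReal.ofReal (y ^ a) * ENNReal.ofReal ((y ^ (-a)) ^ m.natAbs), ?_,
    fun f k t ht => ?_⟩
  · rw [ENNReal.tsum_mul_left]
    exact ENNReal.mul_lt_top (ENNReal.mul_lt_top ENNReal.coe_lt_top ENNReal.ofReal_lt_top)
      (tsum_pow_natAbs_lt_top (by positivity) (Real.rpow_lt_one_of_one_lt_of_neg hy (by linarith)))
  have ht0 : 0 < t := lt_of_lt_of_le (by positivity) ht.1
  refine (mul_le_mul_right (hC f t ht0) _).trans ?_
  rw [← ENNReal.tsum_mul_left]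
  refine ENNReal.tsum_le_tsum fun j => ?_
  have hj : 0 < y ^ j := by positivity
  have key := rpow_mul_min_le hy ha hM (τ := t * y ^ j) (m := j + k)
    (by rw [add_comm, zpow_add₀ hy0.ne']; gcongr; exact ht.1)
    (by rw [add_assoc, add_comm j, zpow_add₀ hy0.ne']; gcongr; exact ht.2)
  -- The time weight splits into a power of `τ`, which goes into the kernel, and the Besov weight of
  -- the `j`-th block.
  have e : t ^ a = (t * y ^ j) ^ a * (2 : ℝ) ^ (j * s) := by
    rw [two_rpow_eq hα, ← Real.mul_rpow (by positivity) (by positivity), zpow_neg,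
      mul_inv_cancel_right₀ hj.ne']
  rw [e, ENNReal.ofReal_mul (by positivity)]
  calc _ = C * ENNReal.ofReal ((t * y ^ j) ^ a * min 1 ((t * y ^ j) ^ M)⁻¹)
        * (ENNReal.ofReal ((2 : ℝ) ^ (j * s)) * eLpNorm (ψ.block j f) p volume) := by
        rw [ENNReal.ofReal_mul (by positivity)]; ring
    _ ≤ C * ENNReal.ofReal (y ^ a * (y ^ (-a)) ^ (j + k).natAbs)
        * (ENNReal.ofReal ((2 : ℝ) ^ (j * s)) * eLpNorm (ψ.block j f) p volume) := by gcongr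
    _ = _ := by rw [ENNReal.ofReal_mul (by positivity)]; ring

theorem heatNorm_lt_top {α s : ℝ} (hα : 0 < α) (hs : s < 0) {p q : ℝ≥0∞} (hp : 1 ≤ p)
    (hq : 1 ≤ q) {f : ZDual n} (hf : ψ.besovNorm s p q f < ⊤) : heatNorm α s p q f < ⊤ := by
  obtain ⟨κ, hκ, h⟩ := ψ.exists_heat_le_block hα hs hp
  have hy : 1 < (2 : ℝ) ^ (2 * α) := Real.one_lt_rpow (by norm_num) (by positivity)
  unfold besovNorm at hf
  unfold heatNorm
  split_ifs at hf ⊢ with hqt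
  · refine lt_of_le_of_lt (iSup₂_le fun t ht => ?_) (ENNReal.mul_lt_top hκ hf)
    obtain ⟨k, hk⟩ := exists_mem_Ico_zpow ht hy
    refine (h f k t hk).trans ?_
    rw [← Equiv.tsum_eq (Equiv.addRight k) κ, ← ENNReal.tsum_mul_right]
    refine ENNReal.tsum_le_tsum fun j => mul_le_mul_right ?_ _
    exact le_iSup (fun j : ℤ => ENNReal.ofReal ((2 : ℝ) ^ (j * s)) * eLpNorm (ψ.block j f) p volume) j
  · have hqr : 1 ≤ q.toReal := by
      rw [← ENNReal.toReal_one]; exact ENNReal.toReal_mono hqt hq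
    rw [ENNReal.rpow_lt_top_iff_of_pos (by positivity)] at hf ⊢
    refine (lintegral_Ioi_le_tsum hy (h f) (by linarith)).trans_lt ?_
    refine ENNReal.mul_lt_top ENNReal.ofReal_lt_top ?_
    refine (tsum_convolution_rpow_le κ _ hqr).trans_lt (ENNReal.mul_lt_top ?_ hf)
    exact ENNReal.rpow_lt_top_of_nonneg (by linarith) hκ.ne

theorem besovNorm_lt_top {α s : ℝ} (hα : 0 < α) (hs : s < 0) {p q : ℝ≥0∞} (hp : 1 ≤ p)
    (hq : 1 ≤ q) {f : ZDual n} (hf : heatNorm α s p q f < ⊤) : ψ.besovNorm s p q f < ⊤ := by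
  obtain ⟨C, h⟩ := ψ.exists_block_le_heat (s := s) hα hs hp
  have hy : 1 < (2 : ℝ) ^ (2 * α) := Real.one_lt_rpow (by norm_num) (by positivity)
  unfold heatNorm at hf
  unfold besovNorm
  split_ifs at hf ⊢ with hqt
  · refine lt_of_le_of_lt (iSup_le fun j => ?_) (ENNReal.mul_lt_top (ENNReal.coe_lt_top (r := C)) hf)
    -- For `q = ∞` one time per block suffices: the left endpoint `t = 2^{-2αj}`.
    have h1 := h f (-j) (((2 : ℝ) ^ (2 * α)) ^ (-j))
      ⟨le_rfl, zpow_lt_zpow_right₀ hy (by omega)⟩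
    rw [neg_neg] at h1
    refine h1.trans (mul_le_mul_right ?_ _)
    exact le_iSup₂ (f := fun (t : ℝ) (_ : 0 < t) =>
      ENNReal.ofReal (t ^ (-s / (2 * α))) * distNorm p (heat α t f)) _ (by positivity)
  · have hqr : 1 ≤ q.toReal := by
      rw [← ENNReal.toReal_one]; exact ENNReal.toReal_mono hqt hq
    rw [ENNReal.rpow_lt_top_iff_of_pos (by positivity)] at hf ⊢
    have h1 := tsum_le_lintegral_Ioi hy (h f) (q := q.toReal) (by linarith)
    have e := (Equiv.neg ℤ).tsum_eq (fun j : ℤ => (ENNReal.ofReal ((2 : ℝ) ^ ((j : ℝ) * s))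
      * eLpNorm (ψ.block j f) p volume) ^ q.toReal)
    simp only [Equiv.neg_apply] at e
    rw [e] at h1
    have hc : ENNReal.ofReal (((2 : ℝ) ^ (2 * α) - 1) / (2 : ℝ) ^ (2 * α)) ≠ 0 := by
      rw [← pos_iff_ne_zero, ENNReal.ofReal_pos]
      exact div_pos (by linarith) (by linarith)
    refine ENNReal.lt_top_of_mul_ne_top_right (ne_top_of_le_ne_top ?_ h1) hc
    have hCq : (C : ℝ≥0∞) ^ q.toReal ≠ ⊤ := ENNReal.rpow_ne_top_of_nonneg (by linarith) (by simp)
    simp_rw [ENNReal.mul_rpow_of_nonneg (C : ℝ≥0∞) _ (by linarith : 0 ≤ q.toReal), mul_assoc]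
    -- The constant is finite, so it can be taken out without knowing that `t ↦ distNorm p (heat α t
    -- f)` is measurable.
    rw [lintegral_const_mul' _ _ hCq]
    exact ENNReal.mul_ne_top hCq hf.ne

end Cutoff

end FracHeat

theorem proposition2p1 (n : ℕ) (ψ : FracHeat.Cutoff n) (p q : ENNReal) (hp : 1 ≤ p) (hq : 1 ≤ q)
    (s : ℝ) (hs : s < 0) (α : ℝ) (hα : 0 < α) (f : FracHeat.ZDual n) :
    f ∈ ψ.besovSpace s p q ↔ FracHeat.heatNorm α s p q f < ⊤ :=
  ⟨ψ.heatNorm_lt_top hα hs hp hq, ψ.besovNorm_lt_top hα hs hp hq⟩
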